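/- Fix a number $d\ge 1$ of knapsack constraints. For a finite universe $U$, a set function $f:2^U\to\mathbb{R}_{\ge 0}$ is submodular if $f(S)+f(T)\ge f(S\cup T)+f(S\cap T)$ for all $S,T\subseteq U$; its extension by expectation is $F:[0,1]^U\to\mathbb{R}$, $$F(\bar y)=\sum_{R\subseteq U} f(R)\prod_{i\in R}y_i\prod_{i\notin R}(1-y_i).$$ Given a cost vector $\bar c(i)\in\mathbb{R}_{\ge0}^d$ for each $i\in U$ and a budget vector $\bar L\in\mathbb{R}_{\ge0}^d$, the discrete problem SUB asks for a set $S\subseteq U$ with $\sum_{i\in S}\bar c(i)\le\bar L$ (coordinatewise) that maximizes $f(S)$; let $\mathcal O$ be its optimal value. The continuous problem asks for a vector $\bar y$ in $P=\{\bar y\in[0,1]^U:\sum_{i\in U}y_i\,\bar c(i)\le\bar L\}$ that maximizes $F(\bar y)$. Let $\mathcal F$ be any class of non-negative submodular functions on finite universes $\{1,\dots,n\}$, $n\ge 0$. Algorithms are deterministic uniform programs with exact real arithmetic, rational constants, comparisons, list operations and an oracle for $F$, each of these operations counting as one step; their input is $(\bar c,\bar L)$, and polynomial time means that the number of steps is at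 most a polynomial in $|U|$ (which may depend on $d$, on $\mathcal F$ and on the program). Such an algorithm is an $\alpha$-approximation for the continuous problem with respect to $\mathcal F$ if, for every $f\in\mathcal F$ and all non-negative costs and budgets, it returns $\bar y\in P$ with $F(\bar y)\ge\alpha\,\mathcal O$; it is a $\beta$-approximation for SUB with respect to $\mathcal F$ if it always returns a set $S$ with $\sum_{i\in S}\bar c(i)\le\bar L$ and $f(S)\ge\beta\,\mathcal O$. **Theorem.** Let $\alpha\in(0,1]$. If there is a deterministic polynomial time $\alpha$-approximation algorithm for the continuous problem with respect to $\mathcal F$, then for every $\varepsilon>0$ there is a deterministic polynomial time $(\alpha-\varepsilon)$-approximation algorithm for SUB with respect to $\mathcal F$. -/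

import Mathlib

namespace SubKnapsack

/-! ## Submodular functions, the extension by expectation, and the two problems -/

/-- Submodularity of a real set function on a finite universe. -/
def IsSubmodular {n : ℕ} (f : Finset (Fin n) → ℝ) : Prop :=
  ∀ S T : Finset (Fin n), f (S ∪ T) + f (S ∩ T) ≤ f S + f T

/-- The extension by expectation `F` of `f`: the expected value of `f R`, where the random set `R`
contains every `i` independently with probability `y i`. -/
def expExt {n : ℕ} (f : Finset (Fin n) → ℝ) (y : Fin n → ℝ) : ℝ :=
  ∑ R : Finset (Fin n), f R * ((∏ i ∈ R, y i) * ∏ i ∈ Rᶜ, (1 - y i))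

/-- `S` meets all the `d` knapsack constraints: its total cost is at most the budget `L` in every
dimension. -/
def IsFeasible {n d : ℕ} (c : Fin n → Fin d → ℝ) (L : Fin d → ℝ) (S : Finset (Fin n)) : Prop :=
  ∀ r, ∑ i ∈ S, c i r ≤ L r

/-- The polytope of fractional feasible solutions. -/
def polytope {n d : ℕ} (c : Fin n → Fin d → ℝ) (L : Fin d → ℝ) : Set (Fin n → ℝ) :=
  {y | (∀ i, 0 ≤ y i ∧ y i ≤ 1) ∧ ∀ r, ∑ i, y i * c i r ≤ L r}

/-- The value of an optimal (integral) solution. For nonnegative budgets this is the maximum of a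
nonempty finite set of reals (the empty set is feasible). -/
noncomputable def optValue {n d : ℕ} (f : Finset (Fin n) → ℝ) (c : Fin n → Fin d → ℝ)
    (L : Fin d → ℝ) : ℝ :=
  sSup (f '' {S | IsFeasible c L S})

/-! ## The machine model

A uniform model of deterministic computation with exact real arithmetic at unit cost (a real RAM
without rounding, whose memory holds pointers to immutable cells) and an oracle. -/

/-- Data: binary trees whose leaves are `nil` or real numbers. -/
inductive Val : Type
  | nil : Val
  | num (x : ℝ) : Val
  | pair (a b : Val) : Val

/-- Programs. A program is a finite object which mentions no numbers but rational ones, and it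
computes a partial function from data to data. -/
inductive Code : Type
  /-- The identity. -/
  | id : Code
  /-- The constant `nil`. -/
  | nil : Code
  /-- A rational constant. -/
  | const (q : ℚ) : Code
  /-- First component of a pair. -/
  | fst : Code
  /-- Second component of a pair. -/
  | snd : Code
  /-- Run two programs on the same input and pair the results. -/
  | pair (a b : Code) : Code
  /-- Run `b`, then run `a` on its result. -/
  | comp (a b : Code) : Code
  /-- Addition of a pair of numbers. -/
  | add : Code
  /-- Subtraction of a pair of numbers. -/
  | sub : Code
  /-- Multiplication of a pair of numbers. -/
  | mul : Code
  /-- Division of a pair of numbers; it gets stuck when the divisor is zero. -/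
  | div : Code
  /-- Comparison of a pair of numbers: `1` for `x ≤ y`, and `nil` otherwise. -/
  | le : Code
  /-- If the result of `t` on the input is not `nil`, then run `a` on the input, else run `b`. -/
  | ite (t a b : Code) : Code
  /-- As long as the result of `t` on the current value is not `nil`, replace the current value by
  the result of `b` on it. -/
  | loop (t b : Code) : Code
  /-- Query the oracle. -/
  | oracle : Code

/-- A list of data, as right-nested pairs that end in `nil`. -/
def Val.ofList : List Val → Val
  | [] => Val.nil
  | a :: l => Val.pair a (Val.ofList l)

/-- A real vector, as the list of its entries. -/
def Val.ofVec {n : ℕ} (y : Fin n → ℝ) : Val :=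
  Val.ofList (List.ofFn fun i => Val.num (y i))

/-- An instance of the problem: the list of the cost vectors of the elements, paired with the
budget vector. -/
def Val.ofInstance {n d : ℕ} (c : Fin n → Fin d → ℝ) (L : Fin d → ℝ) : Val :=
  Val.pair (Val.ofList (List.ofFn fun i => Val.ofVec (c i))) (Val.ofVec L)

/-- A set of elements, as its 0/1 indicator vector. -/
noncomputable def Val.ofSet {n : ℕ} (S : Finset (Fin n)) : Val :=
  Val.ofVec fun i => if i ∈ S then (1 : ℝ) else 0

/-- `Eval G p v w t`: with an oracle for the function `G` on the cube `[0,1]^n`, the program `p`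
halts on input `v` with output `w` after exactly `t` steps. Every elementary operation, every test
and every oracle query is a step. A program for which no rule applies (a component of something
that is not a pair, arithmetic on something that is not a pair of numbers, division by zero, a query
outside the cube) does not halt. Evaluation is deterministic, see `Eval.deterministic`. -/
inductive Eval {n : ℕ} (G : (Fin n → ℝ) → ℝ) : Code → Val → Val → ℕ → Prop
  | id (v : Val) : Eval G Code.id v v 1
  | nil (v : Val) : Eval G Code.nil v Val.nil 1
  | const (q : ℚ) (v : Val) : Eval G (Code.const q) v (Val.num (q : ℝ)) 1
  | fst (a b : Val) : Eval G Code.fst (Val.pair a b) a 1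
  | snd (a b : Val) : Eval G Code.snd (Val.pair a b) b 1
  | pair {a b : Code} {v x y : Val} {s t : ℕ} (ha : Eval G a v x s) (hb : Eval G b v y t) :
      Eval G (Code.pair a b) v (Val.pair x y) (s + t + 1)
  | comp {a b : Code} {v x y : Val} {s t : ℕ} (hb : Eval G b v x s) (ha : Eval G a x y t) :
      Eval G (Code.comp a b) v y (s + t + 1)
  | add (x y : ℝ) : Eval G Code.add (Val.pair (Val.num x) (Val.num y)) (Val.num (x + y)) 1
  | sub (x y : ℝ) : Eval G Code.sub (Val.pair (Val.num x) (Val.num y)) (Val.num (x - y)) 1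
  | mul (x y : ℝ) : Eval G Code.mul (Val.pair (Val.num x) (Val.num y)) (Val.num (x * y)) 1
  | div (x y : ℝ) (hy : y ≠ 0) :
      Eval G Code.div (Val.pair (Val.num x) (Val.num y)) (Val.num (x / y)) 1
  | le_true (x y : ℝ) (h : x ≤ y) :
      Eval G Code.le (Val.pair (Val.num x) (Val.num y)) (Val.num 1) 1
  | le_false (x y : ℝ) (h : ¬ x ≤ y) :
      Eval G Code.le (Val.pair (Val.num x) (Val.num y)) Val.nil 1
  | ite_true {t a b : Code} {v u w : Val} {s s' : ℕ} (ht : Eval G t v u s) (hu : u ≠ Val.nil)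
      (ha : Eval G a v w s') : Eval G (Code.ite t a b) v w (s + s' + 1)
  | ite_false {t a b : Code} {v w : Val} {s s' : ℕ} (ht : Eval G t v Val.nil s)
      (hb : Eval G b v w s') : Eval G (Code.ite t a b) v w (s + s' + 1)
  | loop_stop {t b : Code} {v : Val} {s : ℕ} (ht : Eval G t v Val.nil s) :
      Eval G (Code.loop t b) v v (s + 1)
  | loop_step {t b : Code} {v u v' w : Val} {s s' s'' : ℕ} (ht : Eval G t v u s)
      (hu : u ≠ Val.nil) (hb : Eval G b v v' s') (hl : Eval G (Code.loop t b) v' w s'') :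
      Eval G (Code.loop t b) v w (s + s' + s'' + 1)
  | oracle (y : Fin n → ℝ) (hy : ∀ i, 0 ≤ y i ∧ y i ≤ 1) :
      Eval G Code.oracle (Val.ofVec y) (Val.num (G y)) 1

theorem Val.ofList_injective : Function.Injective Val.ofList := by
  intro l
  induction l with
  | nil => intro m h; cases m with
    | nil => rfl
    | cons b m => simp [Val.ofList] at h
  | cons a l ih => intro m h; cases m with
    | nil => simp [Val.ofList] at h
    | cons b m =>
      simp only [Val.ofList, Val.pair.injEq] at h
      rw [h.1, ih h.2]

theorem Val.ofVec_injective {n : ℕ} : Function.Injective (Val.ofVec (n := n)) := by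
  intro y z h
  have h2 := List.ofFn_injective (Val.ofList_injective h)
  funext i
  simpa using congrFun h2 i

/-- The machine model is deterministic: output and number of steps are unique. -/
theorem Eval.deterministic {n : ℕ} {G : (Fin n → ℝ) → ℝ} {p : Code} {v w w' : Val} {t t' : ℕ}
    (h : Eval G p v w t) (h' : Eval G p v w' t') : w = w' ∧ t = t' := by
  induction h generalizing w' t' with
  | oracle y hy =>
    generalize hv : Val.ofVec y = v at h'
    cases h' with
    | oracle z hz => rw [Val.ofVec_injective hv]; exact ⟨rfl, rfl⟩
  | pair ha hb iha ihb =>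
    cases h' with
    | pair ha' hb' =>
      obtain ⟨rfl, rfl⟩ := iha ha'
      obtain ⟨rfl, rfl⟩ := ihb hb'
      exact ⟨rfl, rfl⟩
  | comp hb ha ihb iha =>
    cases h' with
    | comp hb' ha' =>
      obtain ⟨rfl, rfl⟩ := ihb hb'
      obtain ⟨rfl, rfl⟩ := iha ha'
      exact ⟨rfl, rfl⟩
  | le_true x y h => cases h' with
    | le_true => exact ⟨rfl, rfl⟩
    | le_false _ _ h2 => exact absurd h h2
  | le_false x y h => cases h' with
    | le_true _ _ h2 => exact absurd h2 h
    | le_false => exact ⟨rfl, rfl⟩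
  | ite_true ht hu ha iht iha => cases h' with
    | ite_true ht' _ ha' =>
      obtain ⟨rfl, rfl⟩ := iht ht'
      obtain ⟨rfl, rfl⟩ := iha ha'
      exact ⟨rfl, rfl⟩
    | ite_false ht' _ => exact absurd (iht ht').1 hu
  | ite_false ht hb iht ihb => cases h' with
    | ite_true ht' hu _ => exact absurd (iht ht').1.symm hu
    | ite_false ht' hb' =>
      obtain ⟨-, rfl⟩ := iht ht'
      obtain ⟨rfl, rfl⟩ := ihb hb'
      exact ⟨rfl, rfl⟩
  | loop_stop ht iht => cases h' with
    | loop_stop ht' =>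
      obtain ⟨-, rfl⟩ := iht ht'
      exact ⟨rfl, rfl⟩
    | loop_step ht' hu _ _ => exact absurd (iht ht').1.symm hu
  | loop_step ht hu hb hl iht ihb ihl => cases h' with
    | loop_stop ht' => exact absurd (iht ht').1 hu
    | loop_step ht' _ hb' hl' =>
      obtain ⟨rfl, rfl⟩ := iht ht'
      obtain ⟨rfl, rfl⟩ := ihb hb'
      obtain ⟨rfl, rfl⟩ := ihl hl'
      exact ⟨rfl, rfl⟩
  | _ => cases h'; exact ⟨rfl, rfl⟩

/-! ## Approximation algorithms

In both definitions `𝓕 n` is a set of functions on the subsets of an `n`-element universe, the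
program has an oracle for the extension by expectation of the objective function (which also gives
the objective function itself, at 0/1 vectors), and the dimension `d` is fixed. -/

/-- `A` is a deterministic polynomial time `α`-approximation algorithm for the continuous problem
with respect to the functions in `𝓕`: for all nonnegative costs and budgets it finds a fractional
feasible solution of value at least `α` times the value of an optimal integral solution. -/
def IsContinuousApprox (d : ℕ) (𝓕 : ∀ n : ℕ, Set (Finset (Fin n) → ℝ)) (α : ℝ) (A : Code) : Prop :=
  ∃ p : Polynomial ℕ, ∀ (n : ℕ), ∀ f ∈ 𝓕 n, ∀ (c : Fin n → Fin d → ℝ) (L : Fin d → ℝ),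
    (∀ i r, 0 ≤ c i r) → (∀ r, 0 ≤ L r) →
      ∃ (y : Fin n → ℝ) (t : ℕ),
        Eval (expExt f) A (Val.ofInstance c L) (Val.ofVec y) t ∧ t ≤ p.eval n ∧
          y ∈ polytope c L ∧ α * optValue f c L ≤ expExt f y

/-- `B` is a deterministic polynomial time `β`-approximation algorithm for the discrete problem
with respect to the functions in `𝓕`: for all nonnegative costs and budgets it finds a feasible set
of value at least `β` times the value of an optimal solution. -/
def IsDiscreteApprox (d : ℕ) (𝓕 : ∀ n : ℕ, Set (Finset (Fin n) → ℝ)) (β : ℝ) (B : Code) : Prop :=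
  ∃ p : Polynomial ℕ, ∀ (n : ℕ), ∀ f ∈ 𝓕 n, ∀ (c : Fin n → Fin d → ℝ) (L : Fin d → ℝ),
    (∀ i r, 0 ≤ c i r) → (∀ r, 0 ≤ L r) →
      ∃ (S : Finset (Fin n)) (t : ℕ),
        Eval (expExt f) B (Val.ofInstance c L) (Val.ofSet S) t ∧ t ≤ p.eval n ∧
          IsFeasible c L S ∧ β * optValue f c L ≤ f S

end SubKnapsack

/-!
The discrete problem reduces to the continuous one by guessing, a call of the given algorithm on a
modified instance with the *same* objective function, and rounding.

Guessing. Let `S` be an optimal set. Starting with one element of `S`, the elements of `S` that are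
large relative to the budget left over by the elements chosen before are added `k` times. The `k`
layers are disjoint, so by submodularity the removal of one of them costs at most a `1/k` fraction
of the optimum (`exists_guess`). Hence there are a set `T` of bounded size and a nearly optimal
feasible set `S' ⊇ T` such that all of `S' \ T` is small relative to the residual budget. All sets
`T` of this size are tried (`bestWithin`).

The continuous instance. For the guess `T` the elements of `T` become free, the small elements keep
their costs relative to the residual budget, and all the others get a cost so high that the fraction
in which they are used is negligible (`expExt_le_expExt_zero_out`). Its solution is restricted to
the elements that are allowed and scaled by `1 - 1/k`, which leaves slack in every dimension and
loses little by concavity (`mul_expExt_le_expExt_smul`, `le_expExt_shrink`).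

Rounding. The extension minus a large multiple of the expected squared deviations of the costs is
affine in each coordinate, so the coordinates can be rounded one after the other without decreasing
it (`roundAll_spec`). The variance at the start is small because the items are small. If the
resulting set exceeded a budget by a factor `m`, its penalty would be of order `m ^ 2`, while by
subadditivity its value is only of order `m` times the optimum (`IsSubmodular.le_of_weight`); so the
set is feasible, and its value is nearly that of the fractional solution
(`isFeasible_and_le_of_potential`).

Running time. `PolyTime` says that one program computes a family of values within a polynomial
number of steps. It is closed under the constructions of the algorithm: arithmetic, tests, loops
over lists, table lookups, oracle queries, and calls of the given algorithm.
-/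

namespace SubKnapsack

/-! ### Uniform polynomial time computability -/

/-- What a run of a program depends on besides its input: the size parameter `n` in which running
times are measured, and the oracle. -/
structure Task where
  /-- The size of the universe. -/
  n : ℕ
  /-- The function computed by the oracle. -/
  G : (Fin n → ℝ) → ℝ

/-- A single program computes `v x` from `E x` for every `x`, with the oracle of `π x`, in a number
of steps polynomial in the size of `π x`. The index type `X` is arbitrary: it plays the role of a
context, and `E` says how the variables of the context are laid out in memory. -/
def PolyTime {X : Type} (π : X → Task) (E v : X → Val) : Prop :=
  ∃ (p : Code) (P : Polynomial ℕ), ∀ x, ∃ t,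
    Eval (π x).G p (E x) (v x) t ∧ t ≤ P.eval (π x).n

/-- The numbers `m x` are bounded by a polynomial in the size of `π x`. -/
def PolyBounded {X : Type} (π : X → Task) (m : X → ℕ) : Prop :=
  ∃ Q : Polynomial ℕ, ∀ x, m x ≤ Q.eval (π x).n

theorem PolyBounded.weaken {X : Type} {π : X → Task} {m : X → ℕ} (hm : PolyBounded π m)
    {β : X → Type} : PolyBounded (fun z : Σ x, β x => π z.1) fun z => m z.1 :=
  hm.imp fun _ hQ z => hQ z.1

namespace PolyTime

variable {X : Type} {π : X → Task} {E : X → Val}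

theorem id : PolyTime π E E :=
  ⟨Code.id, 1, fun x => ⟨1, Eval.id _, by simp⟩⟩

theorem nil : PolyTime π E fun _ => Val.nil :=
  ⟨Code.nil, 1, fun x => ⟨1, Eval.nil _, by simp⟩⟩

theorem const (q : ℚ) : PolyTime π E fun _ => Val.num (q : ℝ) :=
  ⟨Code.const q, 1, fun x => ⟨1, Eval.const q _, by simp⟩⟩

theorem natCast (k : ℕ) : PolyTime π E fun _ => Val.num (k : ℝ) := by
  simpa using const (π := π) (E := E) (k : ℚ)

theorem zero : PolyTime π E fun _ => Val.num 0 := by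
  simpa using natCast (π := π) (E := E) 0

theorem one : PolyTime π E fun _ => Val.num 1 := by
  simpa using natCast (π := π) (E := E) 1

theorem comp {u v : X → Val} (hu : PolyTime π E u) (hv : PolyTime π u v) : PolyTime π E v := by
  obtain ⟨p, P, hp⟩ := hu
  obtain ⟨q, Q, hq⟩ := hv
  refine ⟨Code.comp q p, P + Q + 1, fun x => ?_⟩
  obtain ⟨s, hs, hsP⟩ := hp x
  obtain ⟨t, ht, htQ⟩ := hq x
  exact ⟨_, Eval.comp hs ht, by simp; omega⟩

theorem pair {u v : X → Val} (hu : PolyTime π E u) (hv : PolyTime π E v) :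
    PolyTime π E fun x => Val.pair (u x) (v x) := by
  obtain ⟨p, P, hp⟩ := hu
  obtain ⟨q, Q, hq⟩ := hv
  refine ⟨Code.pair p q, P + Q + 1, fun x => ?_⟩
  obtain ⟨s, hs, hsP⟩ := hp x
  obtain ⟨t, ht, htQ⟩ := hq x
  exact ⟨_, Eval.pair hs ht, by simp; omega⟩

theorem fst {u v : X → Val} (h : PolyTime π E fun x => Val.pair (u x) (v x)) : PolyTime π E u :=
  h.comp ⟨Code.fst, 1, fun _ => ⟨1, Eval.fst _ _, by simp⟩⟩

theorem snd {u v : X → Val} (h : PolyTime π E fun x => Val.pair (u x) (v x)) : PolyTime π E v :=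
  h.comp ⟨Code.snd, 1, fun _ => ⟨1, Eval.snd _ _, by simp⟩⟩

theorem add {a b : X → ℝ} (ha : PolyTime π E fun x => Val.num (a x))
    (hb : PolyTime π E fun x => Val.num (b x)) : PolyTime π E fun x => Val.num (a x + b x) :=
  (ha.pair hb).comp ⟨Code.add, 1, fun _ => ⟨1, Eval.add _ _, by simp⟩⟩

theorem sub {a b : X → ℝ} (ha : PolyTime π E fun x => Val.num (a x))
    (hb : PolyTime π E fun x => Val.num (b x)) : PolyTime π E fun x => Val.num (a x - b x) :=
  (ha.pair hb).comp ⟨Code.sub, 1, fun _ => ⟨1, Eval.sub _ _, by simp⟩⟩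

theorem mul {a b : X → ℝ} (ha : PolyTime π E fun x => Val.num (a x))
    (hb : PolyTime π E fun x => Val.num (b x)) : PolyTime π E fun x => Val.num (a x * b x) :=
  (ha.pair hb).comp ⟨Code.mul, 1, fun _ => ⟨1, Eval.mul _ _, by simp⟩⟩

/-- A computation in one context is a computation in any context that maps to it. -/
theorem reindex {Y : Type} (h : Y → X) {v : X → Val} (hv : PolyTime π E v) :
    PolyTime (fun y => π (h y)) (fun y => E (h y)) fun y => v (h y) := by
  obtain ⟨p, P, hp⟩ := hv
  exact ⟨p, P, fun y => hp (h y)⟩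

/-- A computation stays available after the context is extended by one more variable. -/
theorem weaken {β : X → Type} {w : (Σ x, β x) → Val} {v : X → Val} (hv : PolyTime π E v) :
    PolyTime (fun z : Σ x, β x => π z.1) (fun z => Val.pair (E z.1) (w z)) fun z => v z.1 :=
  (fst id).comp (hv.reindex Sigma.fst)

/-- A computation stays available after the context is extended by two more variables. -/
theorem weaken₂ {β : X → Type} {γ : (Σ x, β x) → Type} {u w : (Σ z : Σ x, β x, γ z) → Val}
    {v : X → Val} (hv : PolyTime π E v) :
    PolyTime (fun z : Σ z : Σ x, β x, γ z => π z.1.1)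
      (fun z => Val.pair (Val.pair (E z.1.1) (u z)) (w z)) fun z => v z.1.1 :=
  (fst (fst id)).comp (hv.reindex fun z : Σ z : Σ x, β x, γ z => z.1.1)

/-- Access to the last variable of an extended context. -/
theorem var {u w : X → Val} : PolyTime π (fun z => Val.pair (u z) (w z)) w :=
  snd id

/-- Access to the last variable but one. -/
theorem var₂ {u v w : X → Val} :
    PolyTime π (fun z => Val.pair (Val.pair (u z) (v z)) (w z)) v :=
  snd (fst id)

theorem oracle {y : ∀ x, Fin (π x).n → ℝ} (hy : PolyTime π E fun x => Val.ofVec (y x))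
    (hc : ∀ x i, 0 ≤ y x i ∧ y x i ≤ 1) : PolyTime π E fun x => Val.num ((π x).G (y x)) :=
  hy.comp ⟨Code.oracle, 1, fun x => ⟨1, Eval.oracle _ (hc x), by simp⟩⟩

end PolyTime

/-! ### Decidable predicates -/

/-- A polynomial time test of the predicate `P`, with `nil` for `False`. -/
def PolyTest {X : Type} (π : X → Task) (E : X → Val) (P : X → Prop) : Prop :=
  PolyTime π E fun x => @ite _ (P x) (Classical.dec _) (Val.num 1) Val.nil

section Tests

variable {X : Type} {π : X → Task} {E : X → Val}

theorem PolyTime.ite {P : X → Prop} [∀ x, Decidable (P x)] {u v : X → Val}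
    (hP : PolyTest π E P) (hu : PolyTime π E u) (hv : PolyTime π E v) :
    PolyTime π E fun x => if P x then u x else v x := by
  obtain ⟨r, R, hr⟩ := hP
  obtain ⟨p, P', hp⟩ := hu
  obtain ⟨q, Q, hq⟩ := hv
  refine ⟨Code.ite r p q, R + P' + Q + 1, fun x => ?_⟩
  obtain ⟨a, ha, haR⟩ := hr x
  obtain ⟨s, hs, hsP⟩ := hp x
  obtain ⟨t, ht, htQ⟩ := hq x
  by_cases h : P x
  · simp only [if_pos h] at ha ⊢
    exact ⟨_, Eval.ite_true ha (by simp) hs, by simp; omega⟩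
  · simp only [if_neg h] at ha ⊢
    exact ⟨_, Eval.ite_false ha ht, by simp; omega⟩

theorem PolyTime.ite_num {P : X → Prop} [∀ x, Decidable (P x)] {a b : X → ℝ}
    (hP : PolyTest π E P) (ha : PolyTime π E fun x => Val.num (a x))
    (hb : PolyTime π E fun x => Val.num (b x)) :
    PolyTime π E fun x => Val.num (if P x then a x else b x) := by
  convert PolyTime.ite hP ha hb using 2 with x
  split_ifs <;> rfl

namespace PolyTest

theorem congr {P Q : X → Prop} (hP : PolyTest π E P) (h : ∀ x, P x ↔ Q x) : PolyTest π E Q := by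
  have : P = Q := funext fun x => propext (h x)
  exact this ▸ hP

theorem le {a b : X → ℝ} (ha : PolyTime π E fun x => Val.num (a x))
    (hb : PolyTime π E fun x => Val.num (b x)) : PolyTest π E fun x => a x ≤ b x := by
  refine (ha.pair hb).comp ⟨Code.le, 1, fun x => ⟨1, ?_, by simp⟩⟩
  by_cases h : a x ≤ b x
  · simp only [if_pos h]; exact Eval.le_true _ _ h
  · simp only [if_neg h]; exact Eval.le_false _ _ h

theorem not {P : X → Prop} (hP : PolyTest π E P) : PolyTest π E fun x => ¬ P x := by
  classical
  unfold PolyTest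
  convert PolyTime.ite hP PolyTime.nil PolyTime.one using 2 with x
  by_cases h : P x <;> simp [h]

theorem and {P Q : X → Prop} (hP : PolyTest π E P) (hQ : PolyTest π E Q) :
    PolyTest π E fun x => P x ∧ Q x := by
  classical
  unfold PolyTest
  convert PolyTime.ite hP hQ PolyTime.nil using 2 with x
  by_cases h : P x <;> simp [h]

theorem or {P Q : X → Prop} (hP : PolyTest π E P) (hQ : PolyTest π E Q) :
    PolyTest π E fun x => P x ∨ Q x :=
  (hP.not.and hQ.not).not.congr fun x => by tauto

theorem eq {a b : X → ℝ} (ha : PolyTime π E fun x => Val.num (a x))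
    (hb : PolyTime π E fun x => Val.num (b x)) : PolyTest π E fun x => a x = b x :=
  ((le ha hb).and (le hb ha)).congr fun _ => le_antisymm_iff.symm

theorem finEq {m : X → ℕ} {i j : ∀ x, Fin (m x)}
    (hi : PolyTime π E fun x => Val.num ((i x : ℕ) : ℝ))
    (hj : PolyTime π E fun x => Val.num ((j x : ℕ) : ℝ)) : PolyTest π E fun x => i x = j x :=
  (eq hi hj).congr fun x => by rw [Nat.cast_inj, Fin.val_inj]

end PolyTest

/-- Division, with Lean's convention `a / 0 = 0`: the program tests the divisor beforehand. -/
theorem PolyTime.div {a b : X → ℝ} (ha : PolyTime π E fun x => Val.num (a x))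
    (hb : PolyTime π E fun x => Val.num (b x)) : PolyTime π E fun x => Val.num (a x / b x) := by
  obtain ⟨r, R, hr⟩ := PolyTest.eq hb PolyTime.zero
  obtain ⟨p, P, hp⟩ := ha.pair hb
  refine ⟨Code.ite r (Code.const 0) (Code.comp Code.div p), R + P + 4, fun x => ?_⟩
  obtain ⟨s, hs, hsR⟩ := hr x
  obtain ⟨t, ht, htP⟩ := hp x
  by_cases h : b x = 0
  · simp only [if_pos h] at hs
    simp only [h, div_zero]
    refine ⟨_, Eval.ite_true (w := Val.num 0) (s' := 1) hs (by simp) ?_, by simp; omega⟩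
    simpa using Eval.const (G := (π x).G) 0 (E x)
  · simp only [if_neg h] at hs
    exact ⟨_, Eval.ite_false hs (Eval.comp ht (Eval.div _ _ h)), by simp; omega⟩

end Tests

/-! ### Loops over lists -/

section Loops

variable {X : Type} {π : X → Task} {E : X → Val}

/-- A loop whose state has a rank that decreases by one in every round, and which stops at
rank zero. -/
theorem PolyTime.loop {S : X → Type} {σ : ∀ x, S x → Val} {τ : (Σ x, S x) → Val}
    {rank : ∀ x, S x → ℕ} {next : ∀ x, S x → S x} {s₀ : ∀ x, S x}
    (h₀ : PolyTime π E fun x => σ x (s₀ x))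
    (hτ : PolyTime (fun z : Σ x, S x => π z.1) (fun z => σ z.1 z.2) τ)
    (hτr : ∀ x s, τ ⟨x, s⟩ = Val.nil ↔ rank x s = 0)
    (hnext : PolyTime (fun z : {z : Σ x, S x // rank z.1 z.2 ≠ 0} => π z.1.1)
      (fun z => σ z.1.1 z.1.2) fun z => σ z.1.1 (next z.1.1 z.1.2))
    (hrank : ∀ x s, rank x s ≠ 0 → rank x (next x s) + 1 = rank x s)
    (hb : PolyBounded π fun x => rank x (s₀ x)) :
    PolyTime π E fun x => σ x ((next x)^[rank x (s₀ x)] (s₀ x)) := by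
  obtain ⟨p, P, hp⟩ := hτ
  obtain ⟨q, Q, hq⟩ := hnext
  obtain ⟨R, hR⟩ := hb
  refine h₀.comp ⟨Code.loop p q, (R + 1) * (P + Q + 1), fun x => ?_⟩
  have key : ∀ (k : ℕ) (s : S x), rank x s = k → ∃ t,
      Eval (π x).G (Code.loop p q) (σ x s) (σ x ((next x)^[k] s)) t ∧
        t ≤ (k + 1) * (P.eval (π x).n + Q.eval (π x).n + 1) := by
    intro k
    induction k with
    | zero =>
      intro s hs
      obtain ⟨a, ha, haP⟩ := hp ⟨x, s⟩
      rw [(hτr x s).2 hs] at ha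
      exact ⟨_, Eval.loop_stop ha, by simp at haP; omega⟩
    | succ k ih =>
      intro s hs
      obtain ⟨a, ha, haP⟩ := hp ⟨x, s⟩
      obtain ⟨b, hb, hbQ⟩ := hq ⟨⟨x, s⟩, by simp [hs]⟩
      obtain ⟨c, hc, hcR⟩ := ih (next x s) (by have := hrank x s (by omega); omega)
      refine ⟨_, Eval.loop_step ha (fun h => ?_) hb hc, ?_⟩
      · have := (hτr x s).1 h; omega
      · simp only at haP hbQ
        rw [Nat.succ_mul (k + 1)]
        omega
  obtain ⟨t, ht, htb⟩ := key _ (s₀ x) rfl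
  refine ⟨t, ht, htb.trans ?_⟩
  simp only [Polynomial.eval_mul, Polynomial.eval_add, Polynomial.eval_one]
  exact Nat.mul_le_mul_right _ (Nat.succ_le_succ (hR x))

/-- A left fold over a list of polynomial length whose step is computed in polynomial time. -/
theorem PolyTime.foldl {β γ : X → Type} {e : ∀ x, β x → Val} {σ : ∀ x, γ x → Val}
    {l : ∀ x, List (β x)} {s₀ : ∀ x, γ x} {step : ∀ x, γ x → β x → γ x}
    (hl : PolyTime π E fun x => Val.ofList ((l x).map (e x)))
    (hb : PolyBounded π fun x => (l x).length)
    (h₀ : PolyTime π E fun x => σ x (s₀ x))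
    (hstep : PolyTime (fun z : Σ x, β x × γ x => π z.1)
      (fun z => Val.pair (E z.1) (Val.pair (e z.1 z.2.1) (σ z.1 z.2.2)))
      fun z => σ z.1 (step z.1 z.2.2 z.2.1)) :
    PolyTime π E fun x => σ x ((l x).foldl (step x) (s₀ x)) := by
  -- The state of the loop: the rest of the list and the accumulator.
  let next : ∀ x, List (β x) × γ x → List (β x) × γ x := fun x s =>
    match s with
    | ([], g) => ([], g)
    | (b :: m, g) => (m, step x g b)
  have hit : ∀ x (m : List (β x)) (g : γ x),
      ((next x)^[m.length] (m, g)).2 = m.foldl (step x) g := by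
    intro x m
    induction m with
    | nil => intro g; rfl
    | cons b m ih => intro g; exact ih (step x g b)
  have hloop := PolyTime.loop (S := fun x => List (β x) × γ x)
    (σ := fun x s => Val.pair (E x) (Val.pair (Val.ofList (s.1.map (e x))) (σ x s.2)))
    (τ := fun z => Val.ofList (z.2.1.map (e z.1)))
    (rank := fun x s => s.1.length) (next := next) (s₀ := fun x => (l x, s₀ x))
    (PolyTime.id.pair (hl.pair h₀)) (fst (snd id)) ?_ ?_ ?_ hb
  · have := snd (snd hloop)
    simp only [hit] at this
    exact this
  · rintro x ⟨m, g⟩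
    cases m <;> simp [Val.ofList]
  · -- On a nonempty list the head is available, so the step can be run.
    obtain ⟨p, P, hp⟩ := hstep
    refine ⟨Code.pair Code.fst (Code.pair (Code.comp Code.snd (Code.comp Code.fst Code.snd))
      (Code.comp p (Code.pair Code.fst (Code.pair
        (Code.comp Code.fst (Code.comp Code.fst Code.snd)) (Code.comp Code.snd Code.snd))))),
      P + 22, ?_⟩
    rintro ⟨⟨x, m, g⟩, hm⟩
    cases m with
    | nil => simp at hm
    | cons b m =>
      obtain ⟨t, ht, htP⟩ := hp ⟨x, b, g⟩
      refine ⟨_, Eval.pair (Eval.fst _ _) (Eval.pair (Eval.comp (Eval.comp (Eval.snd _ _)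
        (Eval.fst _ _)) (Eval.snd _ _)) (Eval.comp (Eval.pair (Eval.fst _ _) (Eval.pair
        (Eval.comp (Eval.comp (Eval.snd _ _) (Eval.fst _ _)) (Eval.fst _ _))
        (Eval.comp (Eval.snd _ _) (Eval.snd _ _)))) ht)), ?_⟩
      simp at htP ⊢
      omega
  · rintro x ⟨m, g⟩ hm
    cases m with
    | nil => simp at hm
    | cons b m => rfl

/-- The numbers below `m x` can be listed, in decreasing order, and there are polynomially many. -/
def Loopable (π : X → Task) (E : X → Val) (m : X → ℕ) : Prop :=
  (PolyTime π E fun x =>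
    Val.ofList ((List.finRange (m x)).reverse.map fun i : Fin (m x) => Val.num ((i : ℕ) : ℝ))) ∧
  PolyBounded π m

theorem Loopable.weaken {m : X → ℕ} (hm : Loopable π E m) {β : X → Type}
    {w : (Σ x, β x) → Val} :
    Loopable (fun z : Σ x, β x => π z.1) (fun z => Val.pair (E z.1) (w z)) fun z => m z.1 :=
  ⟨hm.1.weaken, hm.2.weaken⟩

theorem Loopable.weaken₂ {m : X → ℕ} (hm : Loopable π E m) {β : X → Type}
    {γ : (Σ x, β x) → Type} {u w : (Σ z : Σ x, β x, γ z) → Val} :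
    Loopable (fun z : Σ z : Σ x, β x, γ z => π z.1.1)
      (fun z => Val.pair (Val.pair (E z.1.1) (u z)) (w z)) fun z => m z.1.1 :=
  ⟨hm.1.weaken₂, hm.2.weaken.weaken⟩

/-- The positions of a list can be enumerated. -/
theorem Loopable.ofList {l : X → List Val} (hl : PolyTime π E fun x => Val.ofList (l x))
    (hb : PolyBounded π fun x => (l x).length) :
    Loopable π E fun x => (l x).length := by
  refine ⟨?_, hb⟩
  have h := PolyTime.foldl (π := π) (E := E) (β := fun _ => Val) (γ := fun _ => ℕ × List ℕ)
    (e := fun _ v => v)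
    (σ := fun _ s => Val.pair (Val.num (s.1 : ℝ))
      (Val.ofList (s.2.map fun i : ℕ => Val.num (i : ℝ))))
    (l := l) (s₀ := fun _ => (0, [])) (step := fun _ s _ => (s.1 + 1, s.1 :: s.2))
    (by simpa using hl) hb (by simpa [Val.ofList] using PolyTime.zero.pair PolyTime.nil) (by
      have hs := PolyTime.snd (PolyTime.snd (PolyTime.id (π := fun z : Σ _ : X, Val × ℕ × List ℕ =>
        π z.1) (E := fun z => Val.pair (E z.1) (Val.pair z.2.1 (Val.pair (Val.num (z.2.2.1 : ℝ))
          (Val.ofList (z.2.2.2.map fun i : ℕ => Val.num (i : ℝ))))))))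
      simpa [Val.ofList] using (hs.fst.add PolyTime.one).pair (hs.fst.pair hs.snd))
  have key : ∀ (m : List Val) (k : ℕ) (acc : List ℕ),
      (m.foldl (fun (s : ℕ × List ℕ) _ => (s.1 + 1, s.1 :: s.2)) (k, acc)).2 =
        (List.range' k m.length).reverse ++ acc := by
    intro m
    induction m with
    | nil => intro k acc; simp
    | cons v m ih =>
      intro k acc
      rw [List.foldl_cons, ih, List.length_cons, List.range'_succ]
      simp
  have h2 := h.snd
  simp only [key, List.append_nil, ← List.range_eq_range'] at h2
  convert h2 using 4 with x
  rw [List.map_reverse, List.map_reverse, ← List.map_coe_finRange_eq_range, List.map_map]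
  rfl

theorem Loopable.const (d : ℕ) : Loopable π E fun _ => d := by
  have h : PolyTime π E fun _ => Val.ofList (List.replicate d Val.nil) := by
    induction d with
    | zero => exact PolyTime.nil
    | succ d ih => exact PolyTime.nil.pair ih
  simpa using Loopable.ofList h ⟨Polynomial.C d, fun _ => by simp⟩

/-- A loop over the indices below `m x`, starting with the largest. -/
theorem PolyTime.forRange {m : X → ℕ} (hm : Loopable π E m) {γ : X → Type}
    {σ : ∀ x, γ x → Val} {s₀ : ∀ x, γ x} {step : ∀ x, Fin (m x) → γ x → γ x}
    (h₀ : PolyTime π E fun x => σ x (s₀ x))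
    (hstep : PolyTime (fun z : Σ x, Fin (m x) × γ x => π z.1)
      (fun z => Val.pair (E z.1) (Val.pair (Val.num ((z.2.1 : ℕ) : ℝ)) (σ z.1 z.2.2)))
      fun z => σ z.1 (step z.1 z.2.1 z.2.2)) :
    PolyTime π E fun x => σ x ((List.finRange (m x)).foldr (step x) (s₀ x)) := by
  have h := PolyTime.foldl (β := fun x => Fin (m x)) (γ := γ) (σ := σ) (s₀ := s₀)
    (l := fun x => (List.finRange (m x)).reverse)
    (step := fun x g i => step x i g) (e := fun x i => Val.num ((i : ℕ) : ℝ)) hm.1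
    (by simpa using hm.2) h₀ hstep
  simpa only [List.foldl_reverse] using h

/-- Tabulation of a function on the indices below `m x`. -/
theorem PolyTime.tabulate {m : X → ℕ} (hm : Loopable π E m) {v : ∀ x, Fin (m x) → Val}
    (hv : PolyTime (fun z : Σ x, Fin (m x) => π z.1)
      (fun z => Val.pair (E z.1) (Val.num ((z.2 : ℕ) : ℝ))) fun z => v z.1 z.2) :
    PolyTime π E fun x => Val.ofList (List.ofFn (v x)) := by
  have h := PolyTime.forRange hm (γ := fun _ => List Val) (σ := fun _ => Val.ofList)
    (s₀ := fun _ => []) (step := fun x i acc => v x i :: acc) PolyTime.nil (by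
      refine PolyTime.pair (PolyTime.comp ?_ (hv.reindex fun z : Σ x, Fin (m x) × List Val =>
        ⟨z.1, z.2.1⟩)) (PolyTime.snd (PolyTime.snd PolyTime.id))
      exact (PolyTime.fst PolyTime.id).pair (PolyTime.fst (PolyTime.snd PolyTime.id)))
  convert h using 3 with x
  rw [List.ofFn_eq_map]
  induction List.finRange (m x) with
  | nil => rfl
  | cons i l ih => rw [List.map_cons, List.foldr_cons, ih]

theorem PolyTime.ofVec {m : X → ℕ} (hm : Loopable π E m) {a : ∀ x, Fin (m x) → ℝ}
    (ha : PolyTime (fun z : Σ x, Fin (m x) => π z.1)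
      (fun z => Val.pair (E z.1) (Val.num ((z.2 : ℕ) : ℝ))) fun z => Val.num (a z.1 z.2)) :
    PolyTime π E fun x => Val.ofVec (a x) :=
  PolyTime.tabulate hm ha

theorem PolyTime.sum {m : X → ℕ} (hm : Loopable π E m) {a : ∀ x, Fin (m x) → ℝ}
    (ha : PolyTime (fun z : Σ x, Fin (m x) => π z.1)
      (fun z => Val.pair (E z.1) (Val.num ((z.2 : ℕ) : ℝ))) fun z => Val.num (a z.1 z.2)) :
    PolyTime π E fun x => Val.num (∑ i, a x i) := by
  have h := PolyTime.forRange hm (γ := fun _ => ℝ) (σ := fun _ => Val.num)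
    (s₀ := fun _ => 0) (step := fun x i acc => a x i + acc) PolyTime.zero (by
      refine PolyTime.add (PolyTime.comp ?_ (ha.reindex fun z : Σ x, Fin (m x) × ℝ =>
        ⟨z.1, z.2.1⟩)) (PolyTime.snd (PolyTime.snd PolyTime.id))
      exact (PolyTime.fst PolyTime.id).pair (PolyTime.fst (PolyTime.snd PolyTime.id)))
  convert h using 3 with x
  rw [← List.sum_ofFn, List.ofFn_eq_map]
  induction List.finRange (m x) with
  | nil => rfl
  | cons i l ih => rw [List.map_cons, List.foldr_cons, List.sum_cons, ih]

theorem PolyTest.all {m : X → ℕ} (hm : Loopable π E m) {P : ∀ x, Fin (m x) → Prop}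
    (hP : PolyTest (fun z : Σ x, Fin (m x) => π z.1)
      (fun z => Val.pair (E z.1) (Val.num ((z.2 : ℕ) : ℝ))) fun z => P z.1 z.2) :
    PolyTest π E fun x => ∀ i, P x i := by
  classical
  -- All the tests succeed if and only if the number of failures is at most zero.
  have h := PolyTest.le (PolyTime.sum hm (a := fun x i => if P x i then 0 else 1)
    (PolyTime.ite_num hP PolyTime.zero PolyTime.one)) (PolyTime.zero (π := π) (E := E))
  refine h.congr fun x => ⟨fun hx i => ?_, fun hx => by simp [hx]⟩
  by_contra hi
  have := Finset.single_le_sum (f := fun i => if P x i then (0 : ℝ) else 1)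
    (fun i _ => by positivity) (Finset.mem_univ i)
  simp only [if_neg hi] at this
  linarith

/-- Random access to the entries of a list. -/
theorem PolyTime.lookup {m : X → ℕ} {v : ∀ x, Fin (m x) → Val} {i : ∀ x, Fin (m x)}
    (hm : PolyBounded π m)
    (hv : PolyTime π E fun x => Val.ofList (List.ofFn (v x)))
    (hi : PolyTime π E fun x => Val.num ((i x : ℕ) : ℝ)) :
    PolyTime π E fun x => v x (i x) := by
  -- The state of the loop: a counter, and a list which is longer than the counter.
  let S : X → Type := fun _ => {s : ℕ × List Val // s.1 < s.2.length}
  let next : ∀ x, S x → S x := fun x s => ⟨(s.1.1 - 1, if s.1.1 = 0 then s.1.2 else s.1.2.tail), by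
    have := s.2; split_ifs <;> simp <;> omega⟩
  have hit : ∀ x (k : ℕ) (s : S x), s.1.1 = k →
      ∃ l, ((next x)^[k] s).1.2 = s.1.2[s.1.1]'s.2 :: l := by
    intro x k
    induction k with
    | zero =>
      rintro ⟨⟨j, l⟩, hl⟩ rfl
      cases l with
      | nil => simp at hl
      | cons a l => exact ⟨l, rfl⟩
    | succ k ih =>
      rintro ⟨⟨j, l⟩, hl⟩ rfl
      obtain ⟨r, hr⟩ := ih (next x ⟨(k + 1, l), hl⟩) rfl
      refine ⟨r, ?_⟩
      rw [Function.iterate_succ_apply, hr]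
      simp [next]
  have hloop := PolyTime.loop (π := π) (E := E) (S := S)
    (σ := fun x s => Val.pair (Val.num (s.1.1 : ℝ)) (Val.ofList s.1.2))
    (τ := fun z => @_root_.ite _ (1 ≤ ((z.2.1.1 : ℕ) : ℝ)) (Classical.dec _) (Val.num 1) Val.nil)
    (rank := fun x s => s.1.1) (next := next)
    (s₀ := fun x => ⟨(i x, List.ofFn (v x)), by simp⟩)
    (hi.pair hv) (PolyTest.le PolyTime.one (PolyTime.fst PolyTime.id)) ?_ ?_ ?_ ?_
  · obtain ⟨p, P, hp⟩ := hloop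
    refine ⟨Code.comp Code.fst (Code.comp Code.snd p), P + 4, fun x => ?_⟩
    obtain ⟨t, ht, htP⟩ := hp x
    obtain ⟨l, hl⟩ := hit x _ ⟨(i x, List.ofFn (v x)), by simp⟩ rfl
    simp only at ht hl
    rw [hl] at ht
    refine ⟨_, Eval.comp (t := 1) (Eval.comp ht (Eval.snd _ _)) ?_, ?_⟩
    · simpa [Val.ofList] using Eval.fst (G := (π x).G) _ _
    · simp; omega
  · rintro x ⟨⟨k, l⟩, hl⟩
    by_cases hk : 1 ≤ k
    · simp [hk]; omega
    · simp [hk]; omega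
  · refine ⟨Code.pair (Code.comp Code.sub (Code.pair Code.fst (Code.const 1)))
      (Code.comp Code.snd Code.snd), 9, ?_⟩
    rintro ⟨⟨x, ⟨⟨k, l⟩, hl⟩⟩, hk⟩
    obtain ⟨k, rfl⟩ : ∃ j, k = j + 1 := ⟨k - 1, by simp at hk; omega⟩
    cases l with
    | nil => simp at hl
    | cons a l =>
      refine ⟨_, Eval.pair (Eval.comp (t := 1) (Eval.pair (Eval.fst _ _)
        (Eval.const 1 _)) ?_) (Eval.comp (Eval.snd _ _) (Eval.snd _ _)), ?_⟩
      · simpa [next] using Eval.sub (G := (π x).G) ((k : ℝ) + 1) 1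
      · simp
  · rintro x ⟨⟨k, l⟩, hl⟩ hk
    simp [next] at hk ⊢
    omega
  · obtain ⟨Q, hQ⟩ := hm
    exact ⟨Q, fun x => (i x).2.le.trans (hQ x)⟩

theorem PolyTime.get {m : X → ℕ} {a : ∀ x, Fin (m x) → ℝ} {i : ∀ x, Fin (m x)}
    (hm : PolyBounded π m)
    (ha : PolyTime π E fun x => Val.ofVec (a x))
    (hi : PolyTime π E fun x => Val.num ((i x : ℕ) : ℝ)) :
    PolyTime π E fun x => Val.num (a x (i x)) :=
  PolyTime.lookup hm ha hi

theorem PolyTest.mem {m : X → ℕ} {S : ∀ x, Finset (Fin (m x))} {i : ∀ x, Fin (m x)}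
    (hm : PolyBounded π m)
    (hS : PolyTime π E fun x => Val.ofSet (S x))
    (hi : PolyTime π E fun x => Val.num ((i x : ℕ) : ℝ)) :
    PolyTest π E fun x => i x ∈ S x :=
  (PolyTest.le PolyTime.one (PolyTime.get hm hS hi)).congr fun x => by
    by_cases h : i x ∈ S x <;> simp [h]

theorem PolyTime.update {m : X → ℕ} (hm : Loopable π E m) {a : ∀ x, Fin (m x) → ℝ}
    {i : ∀ x, Fin (m x)} {b : X → ℝ} (ha : PolyTime π E fun x => Val.ofVec (a x))
    (hi : PolyTime π E fun x => Val.num ((i x : ℕ) : ℝ))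
    (hb : PolyTime π E fun x => Val.num (b x)) :
    PolyTime π E fun x => Val.ofVec (Function.update (a x) (i x) (b x)) := by
  have h := PolyTime.ofVec hm (a := fun x j => if j = i x then b x else a x j)
    (PolyTime.ite_num (PolyTest.finEq PolyTime.var hi.weaken) hb.weaken
      (PolyTime.get hm.2.weaken ha.weaken PolyTime.var))
  convert h using 3 with x
  ext j
  exact Function.update_apply _ _ _ _

theorem PolyTime.insert {m : X → ℕ} (hm : Loopable π E m) {S : ∀ x, Finset (Fin (m x))}
    {i : ∀ x, Fin (m x)} (hS : PolyTime π E fun x => Val.ofSet (S x))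
    (hi : PolyTime π E fun x => Val.num ((i x : ℕ) : ℝ)) :
    PolyTime π E fun x => Val.ofSet (insert (i x) (S x)) := by
  have h := PolyTime.update hm hS hi PolyTime.one
  unfold Val.ofSet
  convert h using 3 with x
  ext j
  by_cases hj : j = i x
  · subst hj; simp
  · simp [hj]

end Loops

/-! ### The extension by expectation -/

section Extension

variable {n : ℕ}

/-- The probability of `R` under independent sampling with marginals `y`, as a single product. -/
theorem weight_eq_prod (y : Fin n → ℝ) (R : Finset (Fin n)) :
    (∏ i ∈ R, y i) * ∏ i ∈ Rᶜ, (1 - y i) = ∏ i, if i ∈ R then y i else 1 - y i := by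
  rw [← Finset.prod_mul_prod_compl R (fun i => if i ∈ R then y i else 1 - y i)]
  congr 1
  · exact Finset.prod_congr rfl fun i hi => by simp [hi]
  · exact Finset.prod_congr rfl fun i hi => by simp [Finset.mem_compl.1 hi]

theorem weight_nonneg {y : Fin n → ℝ} (hy : ∀ i, 0 ≤ y i ∧ y i ≤ 1) (R : Finset (Fin n)) :
    0 ≤ (∏ i ∈ R, y i) * ∏ i ∈ Rᶜ, (1 - y i) :=
  mul_nonneg (Finset.prod_nonneg fun i _ => (hy i).1)
    (Finset.prod_nonneg fun i _ => sub_nonneg.2 (hy i).2)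

theorem sum_weight (y : Fin n → ℝ) :
    ∑ R : Finset (Fin n), (∏ i ∈ R, y i) * ∏ i ∈ Rᶜ, (1 - y i) = 1 := by
  have h := Finset.prod_add y (fun i => 1 - y i) Finset.univ
  simp only [add_sub_cancel, Finset.prod_const_one, Finset.powerset_univ] at h
  exact (Finset.sum_congr rfl fun R _ => by rw [Finset.compl_eq_univ_sdiff]).trans h.symm

theorem expExt_nonneg {f : Finset (Fin n) → ℝ} (hf : ∀ S, 0 ≤ f S) {y : Fin n → ℝ}
    (hy : ∀ i, 0 ≤ y i ∧ y i ≤ 1) : 0 ≤ expExt f y :=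
  Finset.sum_nonneg fun R _ => mul_nonneg (hf R) (weight_nonneg hy R)

theorem expExt_indicator (f : Finset (Fin n) → ℝ) (S : Finset (Fin n)) :
    expExt f (fun i => if i ∈ S then 1 else 0) = f S := by
  unfold expExt
  rw [Finset.sum_eq_single S]
  · simp [weight_eq_prod]
    rw [Finset.prod_eq_one, mul_one]
    intro i _
    by_cases h : i ∈ S <;> simp [h]
  · intro R _ hR
    rw [weight_eq_prod]
    obtain ⟨i, hi⟩ : ∃ i, ¬ (i ∈ R ↔ i ∈ S) := by
      by_contra! h
      exact hR (Finset.ext h)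
    rw [Finset.prod_eq_zero (Finset.mem_univ i), mul_zero]
    by_cases h : i ∈ S <;> by_cases h' : i ∈ R <;> simp_all
  · simp

/-- Conditioning on whether the element `a` is sampled. -/
theorem expExt_split (f : Finset (Fin n) → ℝ) (y : Fin n → ℝ) (a : Fin n) :
    expExt f y = ∑ R ∈ (Finset.univ.erase a).powerset,
      (y a * f (insert a R) + (1 - y a) * f R) *
        ∏ i ∈ Finset.univ.erase a, if i ∈ R then y i else 1 - y i := by
  unfold expExt
  have hu : (Finset.univ : Finset (Finset (Fin n))) =
      (insert a (Finset.univ.erase a)).powerset := by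
    rw [Finset.insert_erase (Finset.mem_univ a), Finset.powerset_univ]
  rw [hu, Finset.sum_powerset_insert (Finset.notMem_erase a _), ← Finset.sum_add_distrib]
  refine Finset.sum_congr rfl fun R hR => ?_
  have ha : a ∉ R := fun h => Finset.notMem_erase a _ (Finset.mem_powerset.1 hR h)
  rw [weight_eq_prod, weight_eq_prod, ← Finset.mul_prod_erase _ _ (Finset.mem_univ a),
    ← Finset.mul_prod_erase Finset.univ (fun i => if i ∈ insert a R then y i else 1 - y i)
      (Finset.mem_univ a)]
  have hp : (∏ i ∈ Finset.univ.erase a, if i ∈ insert a R then y i else 1 - y i) =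
      ∏ i ∈ Finset.univ.erase a, if i ∈ R then y i else 1 - y i :=
    Finset.prod_congr rfl fun i hi => by simp [(Finset.mem_erase.1 hi).1]
  rw [hp]
  simp only [ha, if_false, Finset.mem_insert_self, if_true]
  ring

/-- The marginal contribution of `a` to a set, whether or not `a` belongs to it. -/
def marginal (f : Finset (Fin n) → ℝ) (a : Fin n) (R : Finset (Fin n)) : ℝ :=
  f (insert a R) - f (R.erase a)

theorem prod_update_erase (y : Fin n → ℝ) (a : Fin n) (b : ℝ) (R : Finset (Fin n)) :
    (∏ i ∈ Finset.univ.erase a,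
      if i ∈ R then Function.update y a b i else 1 - Function.update y a b i) =
    ∏ i ∈ Finset.univ.erase a, if i ∈ R then y i else 1 - y i :=
  Finset.prod_congr rfl fun i hi => by
    rw [Function.update_of_ne (Finset.mem_erase.1 hi).1]

/-- The extension is affine in each coordinate, with the expected marginal as its slope. -/
theorem expExt_update (f : Finset (Fin n) → ℝ) (y : Fin n → ℝ) (a : Fin n) (b : ℝ) :
    expExt f (Function.update y a b) = expExt f y + (b - y a) * expExt (marginal f a) y := by
  rw [expExt_split f _ a, expExt_split f y a, expExt_split (marginal f a) y a, Finset.mul_sum,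
    ← Finset.sum_add_distrib]
  refine Finset.sum_congr rfl fun R hR => ?_
  have ha : a ∉ R := fun h => Finset.notMem_erase a _ (Finset.mem_powerset.1 hR h)
  rw [prod_update_erase, Function.update_self]
  simp only [marginal, Finset.insert_idem, Finset.erase_insert ha, Finset.erase_eq_of_notMem ha]
  ring

/-- If `h` decreases along inclusion, then its extension decreases on the cube. -/
theorem expExt_antitone {h : Finset (Fin n) → ℝ} (hh : ∀ a R, a ∉ R → h (insert a R) ≤ h R)
    {y z : Fin n → ℝ} (hy : ∀ i, 0 ≤ y i ∧ y i ≤ 1) (hz : ∀ i, 0 ≤ z i ∧ z i ≤ 1)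
    (hyz : ∀ i, y i ≤ z i) : expExt h z ≤ expExt h y := by
  -- The coordinates are raised one at a time.
  have key : ∀ s : Finset (Fin n), expExt h (s.piecewise z y) ≤ expExt h y := by
    intro s
    induction s using Finset.induction_on with
    | empty => simp
    | insert a s ha ih =>
      rw [Finset.piecewise_insert, expExt_update]
      have h1 : expExt (marginal h a) (s.piecewise z y) ≤ 0 := by
        refine Finset.sum_nonpos fun R _ => mul_nonpos_of_nonpos_of_nonneg ?_
          (weight_nonneg (fun i => ?_) R)
        · have := hh a (R.erase a) (Finset.notMem_erase a R)
          rw [show insert a (R.erase a) = insert a R by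
            ext j; by_cases hj : j = a <;> simp [hj]] at this
          exact sub_nonpos.2 this
        · by_cases hi : i ∈ s <;> simp [hi, hy i, hz i]
      have h2 : 0 ≤ z a - s.piecewise z y a := by simp [ha, hyz a]
      linarith [mul_nonpos_of_nonneg_of_nonpos h2 h1]
  simpa using key Finset.univ

theorem marginal_insert_le {f : Finset (Fin n) → ℝ} (hf : IsSubmodular f) (a i : Fin n)
    (R : Finset (Fin n)) (hi : i ∉ R) : marginal f a (insert i R) ≤ marginal f a R := by
  unfold marginal
  by_cases hai : i = a
  · subst hai
    simp [Finset.erase_eq_of_notMem hi]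
  · have h := hf (insert a R) ((insert i R).erase a)
    have h1 : insert a R ∪ (insert i R).erase a = insert a (insert i R) := by
      ext j
      by_cases hj : j = a
      · simp [hj]
      · simp only [Finset.mem_union, Finset.mem_insert, Finset.mem_erase]
        tauto
    have h2 : insert a R ∩ (insert i R).erase a = R.erase a := by
      ext j
      by_cases hj : j = a
      · simp [hj]
      · by_cases hj' : j = i
        · subst hj'; simp [hi, hj]
        · simp [hj, hj']
    rw [h1, h2] at h
    linarith

/-- The extension of a nonnegative submodular function loses at most a factor `t` when the
marginals are scaled by `t`, since it is concave along nonnegative directions. -/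
theorem mul_expExt_le_expExt_smul {f : Finset (Fin n) → ℝ} (hf : IsSubmodular f)
    (hf0 : 0 ≤ f ∅) {y : Fin n → ℝ} (hy : ∀ i, 0 ≤ y i ∧ y i ≤ 1) {t : ℝ} (ht0 : 0 ≤ t)
    (ht1 : t ≤ 1) : t * expExt f y ≤ expExt f fun i => t * y i := by
  have hty : ∀ i, 0 ≤ t * y i ∧ t * y i ≤ 1 := fun i =>
    ⟨mul_nonneg ht0 (hy i).1, mul_le_one₀ ht1 (hy i).1 (hy i).2⟩
  -- Telescoping over the coordinates: marginals at the smaller point are larger.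
  have key : ∀ s : Finset (Fin n), t * expExt f (s.piecewise y 0) ≤
      expExt f (s.piecewise (fun i => t * y i) 0) := by
    intro s
    induction s using Finset.induction_on with
    | empty =>
      have h0 : expExt f (0 : Fin n → ℝ) = f ∅ := by
        simpa [Pi.zero_def] using expExt_indicator f ∅
      rw [Finset.piecewise_empty, Finset.piecewise_empty, h0]
      nlinarith
    | insert a s ha ih =>
      rw [Finset.piecewise_insert, Finset.piecewise_insert, expExt_update, expExt_update]
      have h1 : expExt (marginal f a) (s.piecewise y 0) ≤
          expExt (marginal f a) (s.piecewise (fun i => t * y i) 0) := by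
        refine expExt_antitone (marginal_insert_le hf a) (fun i => ?_) (fun i => ?_) fun i => ?_
        · by_cases hi : i ∈ s <;> simp [hi, hty i]
        · by_cases hi : i ∈ s <;> simp [hi, hy i]
        · by_cases hi : i ∈ s
          · simpa [hi] using mul_le_of_le_one_left (hy i).1 ht1
          · simp [hi]
      have h2 := mul_le_mul_of_nonneg_left h1 (hty a).1
      simp only [Finset.piecewise_eq_of_notMem _ _ _ ha, Pi.zero_apply, sub_zero]
      linarith
  simpa using key Finset.univ

/-- Dropping elements that are sampled with probability at most `b` costs at most `b` times the sum
of all values. -/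
theorem expExt_le_expExt_zero_out {f : Finset (Fin n) → ℝ} (hf : ∀ S, 0 ≤ f S) {y : Fin n → ℝ}
    (hy : ∀ i, 0 ≤ y i ∧ y i ≤ 1) {b : ℝ} (hb : 0 ≤ b) {P : Fin n → Prop} [DecidablePred P]
    (hP : ∀ i, ¬ P i → y i ≤ b) :
    expExt f y ≤ expExt f (fun i => if P i then y i else 0) + b * ∑ R, f R := by
  unfold expExt
  rw [Finset.mul_sum, ← Finset.sum_add_distrib]
  refine Finset.sum_le_sum fun R _ => ?_
  have hz : ∀ i, 0 ≤ (if P i then y i else 0) ∧ (if P i then y i else 0) ≤ 1 := fun i => by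
    by_cases h : P i <;> simp [h, hy i]
  by_cases hR : ∀ i ∈ R, P i
  · -- The set `R` remains possible, and its probability does not decrease.
    have h1 : (∏ i ∈ R, y i) * ∏ i ∈ Rᶜ, (1 - y i) ≤
        (∏ i ∈ R, if P i then y i else 0) * ∏ i ∈ Rᶜ, (1 - if P i then y i else 0) := by
      rw [Finset.prod_congr rfl (g := y) fun i hi => if_pos (hR i hi)]
      refine mul_le_mul_of_nonneg_left (Finset.prod_le_prod (fun i _ => ?_) fun i _ => ?_)
        (Finset.prod_nonneg fun i _ => (hy i).1)
      · exact sub_nonneg.2 (hy i).2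
      · by_cases h : P i <;> simp [h, hy i]
    linarith [mul_le_mul_of_nonneg_left h1 (hf R), mul_nonneg hb (hf R)]
  · push Not at hR
    obtain ⟨i, hi, hPi⟩ := hR
    have h1 : (∏ i ∈ R, y i) * ∏ i ∈ Rᶜ, (1 - y i) ≤ b := by
      rw [← Finset.mul_prod_erase R y hi, mul_assoc]
      refine (mul_le_of_le_one_right (hy i).1 (mul_le_one₀ ?_ ?_ ?_)).trans (hP i hPi)
      · exact Finset.prod_le_one (fun j _ => (hy j).1) fun j _ => (hy j).2
      · exact Finset.prod_nonneg fun j _ => sub_nonneg.2 (hy j).2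
      · exact Finset.prod_le_one (fun j _ => sub_nonneg.2 (hy j).2) fun j _ => by
          linarith [(hy j).1]
    linarith [mul_le_mul_of_nonneg_left h1 (hf R), mul_nonneg (hf R) (weight_nonneg hz R)]

/-- If only subsets of `T` are sampled, then the expected value is at most the largest of their
values. -/
theorem expExt_le_of_support {f : Finset (Fin n) → ℝ} {y : Fin n → ℝ}
    (hy : ∀ i, 0 ≤ y i ∧ y i ≤ 1) {T : Finset (Fin n)} (hT : ∀ i, i ∉ T → y i = 0) {b : ℝ}
    (hb : ∀ R ⊆ T, f R ≤ b) : expExt f y ≤ b := by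
  calc expExt f y ≤ ∑ R : Finset (Fin n), b * ((∏ i ∈ R, y i) * ∏ i ∈ Rᶜ, (1 - y i)) := by
        refine Finset.sum_le_sum fun R _ => ?_
        by_cases hR : R ⊆ T
        · exact mul_le_mul_of_nonneg_right (hb R hR) (weight_nonneg hy R)
        · obtain ⟨i, hi, hiT⟩ := Finset.not_subset.1 hR
          simp [Finset.prod_eq_zero hi (hT i hiT)]
    _ = b := by rw [← Finset.mul_sum, sum_weight, mul_one]

theorem sum_eq_two_pow_mul_expExt (f : Finset (Fin n) → ℝ) :
    ∑ R, f R = 2 ^ n * expExt f fun _ => 1 / 2 := by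
  unfold expExt
  rw [Finset.mul_sum]
  refine Finset.sum_congr rfl fun R _ => ?_
  rw [weight_eq_prod]
  have : ∀ i ∈ (Finset.univ : Finset (Fin n)),
      (if i ∈ R then (1 / 2 : ℝ) else 1 - 1 / 2) = 1 / 2 := fun i _ => by split_ifs <;> norm_num
  rw [Finset.prod_congr rfl this, Finset.prod_const, Finset.card_univ, Fintype.card_fin]
  have h2 : (2 : ℝ) ^ n * (1 / 2) ^ n = 1 := by rw [← mul_pow]; norm_num
  linear_combination (-f R) * h2

/-- Half the indicator vector of `T`, which samples a uniformly random subset of `T`. -/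
noncomputable def halfIndicator (T : Finset (Fin n)) (i : Fin n) : ℝ :=
  if i ∈ T then 1 / 2 else 0

theorem halfIndicator_mem (T : Finset (Fin n)) (i : Fin n) :
    0 ≤ halfIndicator T i ∧ halfIndicator T i ≤ 1 := by
  unfold halfIndicator
  split_ifs <;> norm_num

theorem expExt_halfIndicator_pos {f : Finset (Fin n) → ℝ} (hf : ∀ S, 0 ≤ f S)
    {T : Finset (Fin n)} {s : Fin n} (hs : s ∈ T) (hfs : 0 < f {s}) :
    0 < expExt f (halfIndicator T) := by
  unfold expExt
  refine Finset.sum_pos' (fun R _ => mul_nonneg (hf R) (weight_nonneg (halfIndicator_mem T) R))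
    ⟨{s}, Finset.mem_univ _, mul_pos hfs (mul_pos ?_ (Finset.prod_pos fun i _ => ?_))⟩
  · simp [halfIndicator, hs]
  · unfold halfIndicator
    split_ifs <;> norm_num

end Extension

/-! ### Consequences of submodularity -/

section Submodular

variable {n : ℕ} {f : Finset (Fin n) → ℝ}

theorem IsSubmodular.le_add_sdiff (hf : IsSubmodular f) (hf0 : ∀ S, 0 ≤ f S)
    {A S : Finset (Fin n)} (hA : A ⊆ S) : f S ≤ f A + f (S \ A) := by
  have h := hf A (S \ A)
  rw [Finset.union_sdiff_of_subset hA] at h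
  linarith [hf0 (A ∩ (S \ A))]

theorem IsSubmodular.exists_pos_singleton (hf : IsSubmodular f) (hf0 : ∀ S, 0 ≤ f S)
    {S : Finset (Fin n)} (hS : f ∅ < f S) : ∃ s ∈ S, 0 < f {s} := by
  induction S using Finset.induction_on with
  | empty => exact absurd hS (lt_irrefl _)
  | insert a S ha ih =>
    by_cases h : f ∅ < f S
    · obtain ⟨s, hs, h⟩ := ih h
      exact ⟨s, Finset.mem_insert_of_mem hs, h⟩
    · have h2 := hf {a} S
      rw [← Finset.insert_eq] at h2
      exact ⟨a, Finset.mem_insert_self a S, by linarith [hf0 ({a} ∩ S)]⟩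

/-- If every element of `S` has weight at most `1/2` in all dimensions, then `S` can be cut greedily
into few pieces of weight at most one, hence its value is bounded by its total weight times the
largest value of such a piece. -/
theorem IsSubmodular.le_of_weight {d : ℕ} (hf : IsSubmodular f) (hf0 : ∀ S, 0 ≤ f S)
    {a : Fin n → Fin d → ℝ} (ha : ∀ i r, 0 ≤ a i r) {b : ℝ} (S : Finset (Fin n))
    (hS : ∀ i ∈ S, ∀ r, a i r ≤ 1 / 2)
    (hb : ∀ A ⊆ S, (∀ r, ∑ i ∈ A, a i r ≤ 1) → f A ≤ b) :
    f S ≤ (2 * ∑ r, ∑ i ∈ S, a i r + 1) * b := by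
  induction S using Finset.strongInduction with
  | H S ih =>
    have hb0 : 0 ≤ b := (hf0 ∅).trans (hb ∅ (Finset.empty_subset _) (by simp))
    have hw : ∀ A : Finset (Fin n), 0 ≤ ∑ r, ∑ i ∈ A, a i r := fun A =>
      Finset.sum_nonneg fun r _ => Finset.sum_nonneg fun i _ => ha i r
    by_cases hfit : ∀ r, ∑ i ∈ S, a i r ≤ 1
    · nlinarith [hb S subset_rfl hfit, mul_nonneg (hw S) hb0]
    -- A largest piece `A` of weight at most one has weight at least `1/2` in some dimension.
    classical
    obtain ⟨A, hA, hmax⟩ := Finset.exists_max_image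
      (S.powerset.filter fun A => ∀ r, ∑ i ∈ A, a i r ≤ 1) Finset.card ⟨∅, by simp⟩
    rw [Finset.mem_filter, Finset.mem_powerset] at hA
    obtain ⟨hAS, hA1⟩ := hA
    obtain ⟨i, hiS, hiA⟩ : ∃ i ∈ S, i ∉ A := by
      by_contra! h
      exact hfit (Finset.Subset.antisymm hAS h ▸ hA1)
    obtain ⟨r, hr⟩ : ∃ r, 1 < ∑ j ∈ insert i A, a j r := by
      by_contra! h
      have := hmax (insert i A) (by
        rw [Finset.mem_filter, Finset.mem_powerset]
        exact ⟨Finset.insert_subset hiS hAS, h⟩)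
      rw [Finset.card_insert_of_notMem hiA] at this
      omega
    rw [Finset.sum_insert hiA] at hr
    have hwA : 1 / 2 ≤ ∑ r, ∑ i ∈ A, a i r := by
      have := Finset.single_le_sum (f := fun r => ∑ i ∈ A, a i r)
        (fun r _ => Finset.sum_nonneg fun i _ => ha i r) (Finset.mem_univ r)
      linarith [hS i hiS r]
    have hne : A.Nonempty := by
      by_contra h
      rw [Finset.not_nonempty_iff_eq_empty] at h
      subst h
      norm_num at hwA
    have hsub : S \ A ⊂ S := Finset.sdiff_ssubset hAS hne
    have h1 := ih (S \ A) hsub (fun j hj => hS j (hsub.1 hj)) fun B hB => hb B (hB.trans hsub.1)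
    have h2 : ∑ r, ∑ i ∈ S, a i r = ∑ r, ∑ i ∈ S \ A, a i r + ∑ r, ∑ i ∈ A, a i r := by
      rw [← Finset.sum_add_distrib]
      exact Finset.sum_congr rfl fun r _ => (Finset.sum_sdiff hAS).symm
    have h3 := hf.le_add_sdiff hf0 hAS
    have h4 := hb A hAS hA1
    rw [h2]
    nlinarith [mul_le_mul_of_nonneg_right hwA hb0]

end Submodular

/-! ### Guessing the large elements of an optimal solution -/

section Guess

variable {n d : ℕ}

/-- The budget that is left once the elements of `T` are paid for. -/
def residual (c : Fin n → Fin d → ℝ) (L : Fin d → ℝ) (T : Finset (Fin n)) (r : Fin d) : ℝ :=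
  L r - ∑ i ∈ T, c i r

/-- In every dimension the element `i` costs at most a fraction `1/q` of the residual budget. -/
def IsSmall (q : ℕ) (c : Fin n → Fin d → ℝ) (L : Fin d → ℝ) (T : Finset (Fin n))
    (i : Fin n) : Prop :=
  ∀ r, q * c i r ≤ residual c L T r

theorem IsFeasible.mono {c : Fin n → Fin d → ℝ} {L : Fin d → ℝ} (hc : ∀ i r, 0 ≤ c i r)
    {R S : Finset (Fin n)} (hS : IsFeasible c L S) (hRS : R ⊆ S) : IsFeasible c L R := fun r =>
  (Finset.sum_le_sum_of_subset_of_nonneg hRS fun i _ _ => hc i r).trans (hS r)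

theorem sum_sdiff_le_residual {c : Fin n → Fin d → ℝ} {L : Fin d → ℝ} {S T : Finset (Fin n)}
    (hS : IsFeasible c L S) (hT : T ⊆ S) (r : Fin d) :
    ∑ i ∈ S \ T, c i r ≤ residual c L T r := by
  have h := Finset.sum_sdiff (f := fun i => c i r) hT
  unfold residual
  linarith [hS r]

open Classical in
/-- The elements of `S \ T` that are not small with respect to the residual budget of `T`. -/
noncomputable def bigPart (q : ℕ) (c : Fin n → Fin d → ℝ) (L : Fin d → ℝ)
    (S T : Finset (Fin n)) : Finset (Fin n) :=
  (S \ T).filter fun i => ¬ IsSmall q c L T i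

theorem bigPart_subset (q : ℕ) (c : Fin n → Fin d → ℝ) (L : Fin d → ℝ)
    (S T : Finset (Fin n)) : bigPart q c L S T ⊆ S \ T := by
  classical
  exact Finset.filter_subset _ _

theorem card_bigPart_le {q : ℕ} {c : Fin n → Fin d → ℝ} {L : Fin d → ℝ}
    (hc : ∀ i r, 0 ≤ c i r) {S T : Finset (Fin n)} (hS : IsFeasible c L S) (hT : T ⊆ S) :
    (bigPart q c L S T).card ≤ d * q := by
  classical
  let B : Fin d → Finset (Fin n) := fun r =>
    (S \ T).filter fun i => residual c L T r < q * c i r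
  have hB : bigPart q c L S T ⊆ Finset.univ.biUnion B := by
    intro i hi
    rw [bigPart, Finset.mem_filter, IsSmall, not_forall] at hi
    obtain ⟨hi, r, hr⟩ := hi
    exact Finset.mem_biUnion.2 ⟨r, Finset.mem_univ r, Finset.mem_filter.2 ⟨hi, not_le.1 hr⟩⟩
  refine (Finset.card_le_card hB).trans ?_
  have hBr : ∀ r ∈ (Finset.univ : Finset (Fin d)), (B r).card ≤ q := by
    intro r _
    rcases (B r).eq_empty_or_nonempty with h | h
    · simp [h]
    -- The total cost of `B r` is at most the residual budget, and each item exceeds a `1/q` of it.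
    have h1 : (B r).card * residual c L T r < ∑ i ∈ B r, q * c i r := by
      rw [← nsmul_eq_mul, ← Finset.sum_const]
      exact Finset.sum_lt_sum_of_nonempty h fun i hi => (Finset.mem_filter.1 hi).2
    have h2 : ∑ i ∈ B r, c i r ≤ residual c L T r :=
      (Finset.sum_le_sum_of_subset_of_nonneg (Finset.filter_subset _ _)
        fun i _ _ => hc i r).trans (sum_sdiff_le_residual hS hT r)
    have h0 : 0 ≤ residual c L T r := (Finset.sum_nonneg fun i _ => hc i r).trans h2
    rw [← Finset.mul_sum] at h1
    have h3 := h1.trans_le (mul_le_mul_of_nonneg_left h2 (Nat.cast_nonneg q))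
    exact_mod_cast (lt_of_mul_lt_mul_right h3 h0).le
  simpa using Finset.card_biUnion_le_card_mul _ _ _ hBr

/-- Starting from `{s}`, the elements that are large with respect to the current residual budget are
added `k` times. The `k` layers are disjoint, so one of them contributes at most a `1/k` fraction of
the optimal value; it can be dropped, and then only small elements are left beyond the set `T`
built so far. -/
theorem exists_guess {f : Finset (Fin n) → ℝ} (hf : IsSubmodular f) (hf0 : ∀ S, 0 ≤ f S)
    {c : Fin n → Fin d → ℝ} {L : Fin d → ℝ} (hc : ∀ i r, 0 ≤ c i r) {S : Finset (Fin n)}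
    (hS : IsFeasible c L S) (hmax : ∀ R, IsFeasible c L R → f R ≤ f S) {s : Fin n} (hs : s ∈ S)
    (q : ℕ) {k : ℕ} (hk : 1 ≤ k) :
    ∃ T S' : Finset (Fin n), s ∈ T ∧ T.card ≤ 1 + k * (d * q) ∧ T ⊆ S' ∧ S' ⊆ S ∧
      (∀ i ∈ S', i ∉ T → IsSmall q c L T i) ∧ (1 - 1 / k) * f S ≤ f S' := by
  let T : ℕ → Finset (Fin n) := fun j => (fun T => T ∪ bigPart q c L S T)^[j] {s}
  have hT1 : ∀ j, T (j + 1) = T j ∪ bigPart q c L S (T j) := fun j =>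
    Function.iterate_succ_apply' _ _ _
  have hTS : ∀ j, s ∈ T j ∧ T j ⊆ S ∧ (T j).card ≤ 1 + j * (d * q) := by
    intro j
    induction j with
    | zero => simp [T, hs]
    | succ j ih =>
      obtain ⟨h1, h2, h3⟩ := ih
      rw [hT1]
      refine ⟨Finset.mem_union_left _ h1, Finset.union_subset h2
        ((bigPart_subset _ _ _ _ _).trans Finset.sdiff_subset), ?_⟩
      have h4 := Finset.card_union_le (T j) (bigPart q c L S (T j))
      have h5 := card_bigPart_le (q := q) hc hS h2
      rw [Nat.succ_mul]
      omega
  have hstep : ∀ j, f (S \ T (j + 1)) + f S ≤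
      f (S \ T j) + f (S \ bigPart q c L S (T j)) := by
    intro j
    have h := hf (S \ T j) (S \ bigPart q c L S (T j))
    have h1 : S \ T j ∪ S \ bigPart q c L S (T j) = S := by
      rw [← Finset.sdiff_inter_distrib_right, Finset.sdiff_eq_self_iff_disjoint]
      rw [Finset.disjoint_left]
      intro i _ hi
      rw [Finset.mem_inter] at hi
      exact (Finset.mem_sdiff.1 (bigPart_subset _ _ _ _ _ hi.2)).2 hi.1
    have h2 : S \ T j ∩ (S \ bigPart q c L S (T j)) = S \ T (j + 1) := by
      rw [hT1, Finset.sdiff_union_distrib]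
    rw [h1, h2] at h
    linarith
  obtain ⟨j, hjk, hj⟩ : ∃ j < k, (1 - 1 / k) * f S ≤ f (S \ bigPart q c L S (T j)) := by
    by_contra! hcon
    have hlt : ∀ j < k, f (S \ T (j + 1)) < f (S \ T j) - f S / k := fun j hj => by
      have h1 := hcon j hj
      have h2 := hstep j
      rw [sub_mul, one_mul, one_div_mul_eq_div] at h1
      linarith
    have hle : ∀ j, j < k → f (S \ T j) ≤ f S - j * (f S / k) := by
      intro j
      induction j with
      | zero => intro _; simpa using hmax _ (hS.mono hc Finset.sdiff_subset)
      | succ j ih =>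
        intro hj
        have h1 := hlt j (by omega)
        have h2 := ih (by omega)
        push_cast
        linarith
    obtain ⟨k, rfl⟩ : ∃ m, k = m + 1 := ⟨k - 1, by omega⟩
    have h1 := hlt k (by omega)
    have h2 := hle k (by omega)
    have h3 : ((k : ℝ) + 1) * (f S / ((k + 1 : ℕ) : ℝ)) = f S := by
      push_cast
      field_simp
    linarith [hf0 (S \ T (k + 1))]
  refine ⟨T j, S \ bigPart q c L S (T j), (hTS j).1, (hTS j).2.2.trans ?_, ?_,
    Finset.sdiff_subset, ?_, hj⟩
  · have := Nat.mul_le_mul_right (d * q) hjk.le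
    omega
  · intro i hi
    rw [Finset.mem_sdiff]
    exact ⟨(hTS j).2.1 hi, fun h => (Finset.mem_sdiff.1 (bigPart_subset _ _ _ _ _ h)).2 hi⟩
  · intro i hi hiT
    by_contra h
    rw [Finset.mem_sdiff] at hi
    exact hi.2 (by simp [bigPart, hi.1, hiT, h])

end Guess

/-! ### Rounding with a quadratic penalty -/

section Rounding

variable {n d : ℕ}

/-- The expected value of `(∑ i ∈ R, a i - ∑ i, a i * μ i) ^ 2`, where the random set `R` is sampled
with marginals `z`: variance plus squared bias. -/
def penalty (a μ z : Fin n → ℝ) : ℝ :=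
  ∑ i, a i * a i * (z i * (1 - z i)) +
    (∑ i, a i * (z i - μ i)) * ∑ i, a i * (z i - μ i)

/-- The objective of the rounding: the function `G` minus the penalties of all dimensions, for
deviating from the fractional solution `μ`. -/
def potential (G : (Fin n → ℝ) → ℝ) (a : Fin n → Fin d → ℝ) (V : ℝ) (μ z : Fin n → ℝ) : ℝ :=
  G z - V * ∑ r, penalty (fun i => a i r) μ z

/-- `Ψ` is affine in each coordinate. -/
def CoordAffine (Ψ : (Fin n → ℝ) → ℝ) : Prop :=
  ∀ z i b, Ψ (Function.update z i b) =
    (1 - b) * Ψ (Function.update z i 0) + b * Ψ (Function.update z i 1)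

theorem coordAffine_expExt (f : Finset (Fin n) → ℝ) : CoordAffine (expExt f) := fun z i b => by
  rw [expExt_update, expExt_update f z i 0, expExt_update f z i 1]
  ring

theorem sum_update (g : Fin n → ℝ → ℝ) (z : Fin n → ℝ) (i : Fin n) (b : ℝ) :
    ∑ j, g j (Function.update z i b j) = g i b + ∑ j ∈ Finset.univ.erase i, g j (z j) := by
  rw [← Finset.add_sum_erase _ _ (Finset.mem_univ i), Function.update_self]
  congr 1
  exact Finset.sum_congr rfl fun j hj => by
    rw [Function.update_of_ne (Finset.mem_erase.1 hj).1]

theorem coordAffine_penalty (a μ : Fin n → ℝ) : CoordAffine (penalty a μ) := fun z i b => by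
  unfold penalty
  simp only [sum_update (fun j x => a j * a j * (x * (1 - x))),
    sum_update (fun j x => a j * (x - μ j))]
  ring

theorem CoordAffine.potential {G : (Fin n → ℝ) → ℝ} (hG : CoordAffine G)
    (a : Fin n → Fin d → ℝ) (V : ℝ) (μ : Fin n → ℝ) : CoordAffine (potential G a V μ) :=
  fun z i b => by
    unfold SubKnapsack.potential
    rw [hG z i b, Finset.sum_congr rfl fun r _ => coordAffine_penalty (fun i => a i r) μ z i b,
      Finset.sum_add_distrib, ← Finset.mul_sum, ← Finset.mul_sum]
    ring

/-- The points of the unit cube. -/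
abbrev Cube (n : ℕ) : Type := {y : Fin n → ℝ // ∀ i, 0 ≤ y i ∧ y i ≤ 1}

/-- Change of one coordinate to `0` or `1`. -/
def Cube.set (z : Cube n) (i : Fin n) (b : Bool) : Cube n :=
  ⟨Function.update z.1 i (if b then 1 else 0), fun j => by
    by_cases h : j = i
    · subst h; cases b <;> simp
    · simpa [h] using z.2 j⟩

open Classical in
/-- Rounding of the coordinate `i` to the better one of its two extreme values. A coordinate that
is zero already stays so, which keeps excluded elements out of the solution. -/
noncomputable def roundStep (Ψ : (Fin n → ℝ) → ℝ) (i : Fin n) (z : Cube n) : Cube n :=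
  if z.1 i ≤ 0 then z
  else if Ψ (z.set i false).1 ≤ Ψ (z.set i true).1 then z.set i true else z.set i false

/-- Rounding of all coordinates, one after the other. -/
noncomputable def roundAll (Ψ : (Fin n → ℝ) → ℝ) (z : Cube n) : Cube n :=
  (List.finRange n).foldr (roundStep Ψ) z

theorem roundStep_spec {Ψ : (Fin n → ℝ) → ℝ} (hΨ : CoordAffine Ψ) (i : Fin n) (z : Cube n) :
    Ψ z.1 ≤ Ψ (roundStep Ψ i z).1 ∧
      ((roundStep Ψ i z).1 i = 0 ∨ (roundStep Ψ i z).1 i = 1) ∧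
      (∀ j, j ≠ i → (roundStep Ψ i z).1 j = z.1 j) ∧
      (z.1 i = 0 → (roundStep Ψ i z).1 i = 0) := by
  have h := hΨ z.1 i (z.1 i)
  rw [Function.update_eq_self] at h
  unfold roundStep
  split_ifs with h0 h1
  · exact ⟨le_rfl, Or.inl (le_antisymm h0 (z.2 i).1), fun _ _ => rfl, fun h => h⟩
  · simp only [Cube.set, Bool.false_eq_true, if_false, if_true] at h1 ⊢
    refine ⟨?_, by simp, fun j hj => by simp [hj], fun h => absurd h.le h0⟩
    nlinarith [z.2 i]
  · simp only [Cube.set, Bool.false_eq_true, if_false, if_true] at h1 ⊢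
    refine ⟨?_, by simp, fun j hj => by simp [hj], fun h => absurd h.le h0⟩
    nlinarith [z.2 i]

theorem roundAll_spec {Ψ : (Fin n → ℝ) → ℝ} (hΨ : CoordAffine Ψ) (z : Cube n) :
    Ψ z.1 ≤ Ψ (roundAll Ψ z).1 ∧ ∀ i, ((roundAll Ψ z).1 i = 0 ∨ (roundAll Ψ z).1 i = 1) ∧
      (z.1 i = 0 → (roundAll Ψ z).1 i = 0) := by
  have key : ∀ l : List (Fin n), Ψ z.1 ≤ Ψ (l.foldr (roundStep Ψ) z).1 ∧
      ∀ i, (i ∈ l → (l.foldr (roundStep Ψ) z).1 i = 0 ∨ (l.foldr (roundStep Ψ) z).1 i = 1) ∧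
        (z.1 i = 0 → (l.foldr (roundStep Ψ) z).1 i = 0) := by
    intro l
    induction l with
    | nil => simp
    | cons j l ih =>
      obtain ⟨h1, h2, h3, h4⟩ := roundStep_spec hΨ j (l.foldr (roundStep Ψ) z)
      rw [List.foldr_cons]
      refine ⟨ih.1.trans h1, fun i => ?_⟩
      by_cases hij : i = j
      · subst hij
        exact ⟨fun _ => h2, fun h => h4 ((ih.2 i).2 h)⟩
      · rw [h3 i hij]
        exact ⟨fun h => (ih.2 i).1 ((List.mem_cons.1 h).resolve_left hij), (ih.2 i).2⟩
  exact ⟨(key _).1, fun i => ⟨((key _).2 i).1 (List.mem_finRange i), ((key _).2 i).2⟩⟩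

open Classical in
/-- The set of elements selected by the rounding. -/
noncomputable def roundSet (Ψ : (Fin n → ℝ) → ℝ) (z : Cube n) : Finset (Fin n) :=
  Finset.univ.filter fun i => 1 ≤ (roundAll Ψ z).1 i

theorem roundAll_eq_indicator {Ψ : (Fin n → ℝ) → ℝ} (hΨ : CoordAffine Ψ) (z : Cube n) :
    (roundAll Ψ z).1 = fun i => if i ∈ roundSet Ψ z then 1 else 0 := by
  funext i
  rcases ((roundAll_spec hΨ z).2 i).1 with h | h <;> simp [roundSet, h]

end Rounding

/-! ### The value of a rounded solution -/

section Candidate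

variable {n d : ℕ}

open Classical in
/-- The costs of the continuous instance for the guess `T`, normalized to budgets equal to one: the
elements of `T` are free, small elements keep their relative cost (a small element costs nothing in
a dimension without residual budget, in accordance with `x / 0 = 0`), and all the other elements get
the prohibitive cost `M`. -/
noncomputable def resCost (q : ℕ) (c : Fin n → Fin d → ℝ) (L : Fin d → ℝ) (T : Finset (Fin n))
    (M : ℝ) (i : Fin n) (r : Fin d) : ℝ :=
  if i ∈ T then 0 else if IsSmall q c L T i then c i r / residual c L T r else M

/-- The elements that may be used with the guess `T`. -/
def IsAllowed (q : ℕ) (c : Fin n → Fin d → ℝ) (L : Fin d → ℝ) (T : Finset (Fin n))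
    (i : Fin n) : Prop :=
  i ∈ T ∨ IsSmall q c L T i

open Classical in
/-- The fractional solution `y` restricted to the allowed elements and scaled by `1 - 1 / k`. -/
noncomputable def shrink (q k : ℕ) (c : Fin n → Fin d → ℝ) (L : Fin d → ℝ)
    (T : Finset (Fin n)) (y : Fin n → ℝ) (i : Fin n) : ℝ :=
  if IsAllowed q c L T i then (1 - 1 / (k : ℝ)) * y i else 0

variable {q : ℕ} {c : Fin n → Fin d → ℝ} {L : Fin d → ℝ} {T : Finset (Fin n)} {M : ℝ}

theorem resCost_nonneg (hc : ∀ i r, 0 ≤ c i r) (hM : 0 ≤ M) (i : Fin n) (r : Fin d) :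
    0 ≤ resCost q c L T M i r := by
  unfold resCost
  split_ifs with h1 h2
  · exact le_rfl
  · exact div_nonneg (hc i r) ((mul_nonneg (Nat.cast_nonneg q) (hc i r)).trans (h2 r))
  · exact hM

theorem resCost_le (hq : 0 < q) (hc : ∀ i r, 0 ≤ c i r) {i : Fin n}
    (hi : IsAllowed q c L T i) (r : Fin d) : resCost q c L T M i r ≤ 1 / q := by
  have hq' : (0 : ℝ) < q := Nat.cast_pos.2 hq
  unfold resCost
  split_ifs with h1 h2
  · positivity
  · have h3 := h2 r
    rcases ((mul_nonneg hq'.le (hc i r)).trans h3).eq_or_lt with h0 | h0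
    · rw [← h0, div_zero]; positivity
    · rw [div_le_div_iff₀ h0 hq']; linarith
  · exact absurd hi (by simp [IsAllowed, h1, h2])

theorem resCost_mul_residual (hq : 0 < q) (hc : ∀ i r, 0 ≤ c i r) {i : Fin n} (hiT : i ∉ T)
    (hi : IsSmall q c L T i) (r : Fin d) :
    resCost q c L T M i r * residual c L T r = c i r := by
  have hq' : (0 : ℝ) < q := Nat.cast_pos.2 hq
  rw [resCost, if_neg hiT, if_pos hi]
  by_cases h0 : residual c L T r = 0
  · have h1 := hi r
    rw [h0] at h1 ⊢
    nlinarith [hc i r]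
  · exact div_mul_cancel₀ _ h0

/-- Solutions of the normalized instance that use allowed elements only are feasible. -/
theorem isFeasible_of_resCost (hq : 0 < q) (hc : ∀ i r, 0 ≤ c i r) (hM : 0 ≤ M)
    (hT : IsFeasible c L T) {S : Finset (Fin n)} (hS : ∀ i ∈ S, IsAllowed q c L T i)
    (h1 : ∀ r, ∑ i ∈ S, resCost q c L T M i r ≤ 1) : IsFeasible c L S := by
  intro r
  have h0 : 0 ≤ residual c L T r := sub_nonneg.2 (hT r)
  have h2 : ∑ i ∈ S \ T, c i r = (∑ i ∈ S \ T, resCost q c L T M i r) * residual c L T r := by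
    rw [Finset.sum_mul]
    refine Finset.sum_congr rfl fun i hi => ?_
    rw [Finset.mem_sdiff] at hi
    exact (resCost_mul_residual hq hc hi.2 ((hS i hi.1).resolve_left hi.2) r).symm
  have h3 : ∑ i ∈ S \ T, resCost q c L T M i r ≤ 1 :=
    (Finset.sum_le_sum_of_subset_of_nonneg Finset.sdiff_subset
      fun i _ _ => resCost_nonneg hc hM i r).trans (h1 r)
  have h4 : ∑ i ∈ S, c i r ≤ ∑ i ∈ S \ T, c i r + ∑ i ∈ T, c i r := by
    rw [← Finset.sum_sdiff (Finset.inter_subset_left (s₁ := S) (s₂ := T)),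
      Finset.sdiff_inter_self_left]
    exact add_le_add_right (Finset.sum_le_sum_of_subset_of_nonneg Finset.inter_subset_right
      fun i _ _ => hc i r) _
  have h5 := mul_le_mul_of_nonneg_right h3 h0
  rw [← h2] at h5
  unfold residual at h5
  linarith

/-- A feasible extension of `T` by small elements is a solution of the normalized instance. -/
theorem isFeasible_resCost {S : Finset (Fin n)} (hc : ∀ i r, 0 ≤ c i r)
    (hS : IsFeasible c L S) (hTS : T ⊆ S) (hsmall : ∀ i ∈ S, i ∉ T → IsSmall q c L T i) :
    IsFeasible (resCost q c L T M) (fun _ => 1) S := by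
  intro r
  have h1 := sum_sdiff_le_residual hS hTS r
  have h2 : ∑ i ∈ S, resCost q c L T M i r = (∑ i ∈ S \ T, c i r) / residual c L T r := by
    rw [← Finset.sum_sdiff hTS, Finset.sum_div]
    have h3 : ∑ i ∈ T, resCost q c L T M i r = 0 :=
      Finset.sum_eq_zero fun i hi => by simp [resCost, hi]
    rw [h3, add_zero]
    refine Finset.sum_congr rfl fun i hi => ?_
    rw [Finset.mem_sdiff] at hi
    rw [resCost, if_neg hi.2, if_pos (hsmall i hi.1 hi.2)]
  rw [h2]
  exact div_le_one_of_le₀ h1 ((Finset.sum_nonneg fun i _ => hc i r).trans h1)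

theorem penalty_self_le {a y : Fin n → ℝ} {κ : ℝ} (hκ : 0 ≤ κ) (ha : ∀ i, 0 ≤ a i)
    (hy : ∀ i, 0 ≤ y i ∧ y i ≤ 1) (haκ : ∀ i, y i ≠ 0 → a i ≤ κ) (h1 : ∑ i, a i * y i ≤ 1) :
    penalty a y y ≤ κ := by
  unfold penalty
  simp only [sub_self, mul_zero, Finset.sum_const_zero, add_zero]
  calc ∑ i, a i * a i * (y i * (1 - y i)) ≤ ∑ i, κ * (a i * y i) := by
        refine Finset.sum_le_sum fun i _ => ?_
        by_cases h : y i = 0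
        · simp [h]
        · have h2 := mul_nonneg (ha i) (hy i).1
          have h3 := mul_le_mul_of_nonneg_right (haκ i h) h2
          nlinarith [mul_nonneg (mul_nonneg (ha i) h2) (hy i).1]
    _ ≤ κ := by rw [← Finset.mul_sum]; exact mul_le_of_le_one_right hκ h1

theorem penalty_indicator (a μ : Fin n → ℝ) (S : Finset (Fin n)) :
    penalty a μ (fun i => if i ∈ S then 1 else 0) = (∑ i ∈ S, a i - ∑ i, a i * μ i) ^ 2 := by
  unfold penalty
  have h1 : ∑ i, a i * a i * ((if i ∈ S then (1 : ℝ) else 0) * (1 - if i ∈ S then 1 else 0)) = 0 :=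
    Finset.sum_eq_zero fun i _ => by split_ifs <;> simp
  have h2 : ∑ i, a i * ((if i ∈ S then (1 : ℝ) else 0) - μ i) =
      ∑ i ∈ S, a i - ∑ i, a i * μ i := by
    simp only [mul_sub, Finset.sum_sub_distrib, mul_ite, mul_one, mul_zero]
    rw [Finset.sum_ite_mem, Finset.univ_inter]
  rw [h1, h2]
  ring

theorem le_optValue {f : Finset (Fin n) → ℝ} {S : Finset (Fin n)} (hS : IsFeasible c L S) :
    f S ≤ optValue f c L :=
  le_csSup ((Set.toFinite _).image f).bddAbove ⟨S, hS, rfl⟩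

/-- If the guess `T` is right, which is witnessed by `S'`, then the fractional solution loses little
by the restriction to allowed elements and the scaling. -/
theorem le_expExt_shrink {f : Finset (Fin n) → ℝ} (hf : IsSubmodular f) (hf0 : ∀ S, 0 ≤ f S)
    (hc : ∀ i r, 0 ≤ c i r) (hd : 1 ≤ d) {k : ℕ} (hk : 1 ≤ k) {opt : ℝ}
    (hopt : ∀ R, IsFeasible c L R → f R ≤ opt) {S' : Finset (Fin n)} (hS' : IsFeasible c L S')
    (hTS' : T ⊆ S') (hsmall : ∀ i ∈ S', i ∉ T → IsSmall q c L T i)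
    (hval : (1 - 1 / k) * opt ≤ f S') (hpos : 0 < expExt f (halfIndicator T)) {α : ℝ}
    (hα0 : 0 ≤ α) (hα1 : α ≤ 1)
    (hM : M = 2 ^ n * expExt f (fun _ => 1 / 2) * k / expExt f (halfIndicator T))
    {y : Fin n → ℝ} (hy : y ∈ polytope (resCost q c L T M) (fun _ => 1))
    (hyα : α * optValue f (resCost q c L T M) (fun _ => 1) ≤ expExt f y) :
    (α - 3 / k) * opt ≤ expExt f (shrink q k c L T y) := by
  classical
  have hk0 : (0 : ℝ) < k := by positivity
  have hT := hS'.mono hc hTS'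
  obtain ⟨hy01, hyP⟩ := hy
  rw [← sum_eq_two_pow_mul_expExt] at hM
  set m₀ := expExt f (halfIndicator T) with hm₀
  have hm₀opt : m₀ ≤ opt := expExt_le_of_support (halfIndicator_mem T)
    (fun i hi => by simp [halfIndicator, hi]) fun R hR => hopt R (hT.mono hc hR)
  have htot : 0 < ∑ R, f R := by
    refine hpos.trans_le (expExt_le_of_support (T := Finset.univ) (halfIndicator_mem T)
      (by simp) fun R _ => ?_)
    exact Finset.single_le_sum (f := f) (fun S _ => hf0 S) (Finset.mem_univ R)
  have hMpos : 0 < M := by rw [hM]; positivity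
  have h1 : α * ((1 - 1 / k) * opt) ≤ expExt f y :=
    (mul_le_mul_of_nonneg_left (hval.trans
      (le_optValue (isFeasible_resCost hc hS' hTS' hsmall))) hα0).trans hyα
  -- An excluded element has cost `M`, so its share is at most `1 / M`.
  have h2 : ∀ i, ¬ IsAllowed q c L T i → y i ≤ 1 / M := by
    intro i hi
    rw [IsAllowed, not_or] at hi
    have h3 := Finset.single_le_sum (f := fun i => y i * resCost q c L T M i ⟨0, hd⟩)
      (fun j _ => mul_nonneg (hy01 j).1 (resCost_nonneg hc hMpos.le j _)) (Finset.mem_univ i)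
    have h4 := h3.trans (hyP ⟨0, hd⟩)
    simp only [resCost, if_neg hi.1, if_neg hi.2] at h4
    rwa [le_div_iff₀ hMpos]
  have h3 := expExt_le_expExt_zero_out hf0 hy01 (one_div_nonneg.2 hMpos.le) h2
  have h4 : 1 / M * ∑ R, f R = 1 / k * m₀ := by
    rw [hM]; field_simp
  have hk1 : 1 / (k : ℝ) ≤ 1 := by
    rw [div_le_one hk0]; exact_mod_cast hk
  have hu0 : 0 ≤ 1 / (k : ℝ) := by positivity
  have h5 := mul_expExt_le_expExt_smul hf (hf0 ∅) (y := fun i => if IsAllowed q c L T i then y i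
    else 0) (fun i => by by_cases h : IsAllowed q c L T i <;> simp [h, hy01 i])
    (t := 1 - 1 / k) (by linarith) (by linarith)
  have h6 : (fun i => (1 - 1 / (k : ℝ)) * if IsAllowed q c L T i then y i else 0) =
      shrink q k c L T y := by
    funext i
    unfold shrink
    split_ifs <;> simp
  rw [h6] at h5
  rw [h4] at h3
  set u := 1 / (k : ℝ) with hu
  have h7 : 3 / (k : ℝ) = 3 * u := by rw [hu]; ring
  have hopt0 : 0 ≤ opt := hpos.le.trans hm₀opt
  rw [h7]
  refine le_trans ?_ h5
  have h8 : α * ((1 - u) * opt) - u * opt ≤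
      expExt f fun i => if IsAllowed q c L T i then y i else 0 := by
    linarith [mul_le_mul_of_nonneg_left hm₀opt hu0]
  refine le_trans ?_ (mul_le_mul_of_nonneg_left h8 (sub_nonneg.2 hk1))
  have h9 : (1 - u) * (α * ((1 - u) * opt) - u * opt) - (α - 3 * u) * opt =
      opt * (2 * u * (1 - α) + u * u * (1 + α)) := by ring
  have h10 : 0 ≤ opt * (2 * u * (1 - α) + u * u * (1 + α)) := by
    have : 0 ≤ 1 - α := by linarith
    positivity
  linarith

/-- If the fractional solution has a large value, then a set whose potential is no smaller is
feasible: exceeding a budget by a factor `m` would cost a penalty of order `m ^ 2`, while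
submodularity bounds the value by an order of `m` times the optimum. The factor `3 * d * k ^ 3` makes
the penalty prevail, since the slack `1 / k` enters it squared and the optimum is at most `k` times
the value of the fractional solution; `q` is chosen such that the initial penalty is at most a `1/k`
fraction of that value. -/
theorem isFeasible_and_le_of_potential {f : Finset (Fin n) → ℝ} (hf : IsSubmodular f)
    (hf0 : ∀ S, 0 ≤ f S) (hc : ∀ i r, 0 ≤ c i r) (hM : 0 ≤ M) (hd : 1 ≤ d) {k : ℕ} (hk : 2 ≤ k)
    (hq : q = 3 * d ^ 2 * k ^ 4) {opt : ℝ} (hopt0 : 0 < opt)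
    (hopt : ∀ R, IsFeasible c L R → f R ≤ opt) (hT : IsFeasible c L T) {y : Fin n → ℝ}
    (hy : y ∈ polytope (resCost q c L T M) (fun _ => 1))
    (hφ : 1 / k * opt ≤ expExt f (shrink q k c L T y))
    {S : Finset (Fin n)} (hS : ∀ i ∈ S, IsAllowed q c L T i)
    (hpot : potential (expExt f) (resCost q c L T M)
        (3 * d * k ^ 3 * expExt f (shrink q k c L T y)) (shrink q k c L T y)
        (shrink q k c L T y) ≤
      potential (expExt f) (resCost q c L T M)
        (3 * d * k ^ 3 * expExt f (shrink q k c L T y)) (shrink q k c L T y)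
        (fun i => if i ∈ S then 1 else 0)) :
    IsFeasible c L S ∧ (1 - 1 / k) * expExt f (shrink q k c L T y) ≤ f S := by
  obtain ⟨hy01, hyP⟩ := hy
  have hk2 : (2 : ℝ) ≤ k := by exact_mod_cast hk
  have hk0 : (0 : ℝ) < k := by linarith
  have hd1 : (1 : ℝ) ≤ d := by exact_mod_cast hd
  have hd0 : (0 : ℝ) < d := by linarith
  have hq3 : 3 ≤ q := by
    rw [hq, mul_assoc]
    exact Nat.le_mul_of_pos_right 3 (by positivity)
  have hq0 : 0 < q := by omega
  have hqR : (q : ℝ) = 3 * d ^ 2 * k ^ 4 := by rw [hq]; push_cast; ring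
  set y₁ := shrink q k c L T y with hy₁
  set φ := expExt f y₁ with hφdef
  set a := resCost q c L T M with ha
  have ha0 : ∀ i r, 0 ≤ a i r := resCost_nonneg hc hM
  have hu0 : 0 < 1 / (k : ℝ) := by positivity
  have hu1 : 1 / (k : ℝ) < 1 := by rw [div_lt_one hk0]; linarith
  have hφ0 : 0 < φ := lt_of_lt_of_le (by positivity) hφ
  have hy₁le : ∀ i, 0 ≤ y₁ i ∧ y₁ i ≤ (1 - 1 / k) * y i := fun i => by
    have h := mul_nonneg (sub_nonneg.2 hu1.le) (hy01 i).1
    rw [hy₁]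
    unfold shrink
    split_ifs
    · exact ⟨h, le_rfl⟩
    · exact ⟨le_rfl, h⟩
  have hy₁01 : ∀ i, 0 ≤ y₁ i ∧ y₁ i ≤ 1 := fun i =>
    ⟨(hy₁le i).1, (hy₁le i).2.trans (mul_le_one₀ (by linarith) (hy01 i).1 (hy01 i).2)⟩
  -- The scaling leaves a slack of `1 / k` in every dimension.
  have hslack : ∀ r, ∑ i, a i r * y₁ i ≤ 1 - 1 / k := fun r => by
    calc ∑ i, a i r * y₁ i ≤ ∑ i, (1 - 1 / k) * (y i * a i r) :=
          Finset.sum_le_sum fun i _ => by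
            linarith [mul_le_mul_of_nonneg_left (hy₁le i).2 (ha0 i r)]
      _ ≤ 1 - 1 / k := by
          rw [← Finset.mul_sum]
          exact mul_le_of_le_one_right (by linarith) (hyP r)
  have hpen : ∑ r, penalty (fun i => a i r) y₁ y₁ ≤ d * (1 / q) := by
    have h : ∀ r ∈ (Finset.univ : Finset (Fin d)), penalty (fun i => a i r) y₁ y₁ ≤ 1 / q := by
      intro r _
      refine penalty_self_le (by positivity) (fun i => ha0 i r) hy₁01 (fun i hi => ?_)
        ((hslack r).trans (by linarith))
      refine resCost_le hq0 hc ?_ r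
      by_contra h
      exact hi (by rw [hy₁, shrink, if_neg h])
    simpa using Finset.sum_le_card_nsmul _ _ _ h
  have hstart : (1 - 1 / k) * φ ≤ potential (expExt f) a (3 * d * k ^ 3 * φ) y₁ y₁ := by
    have h1 : 3 * d * k ^ 3 * φ * (d * (1 / q)) = 1 / k * φ := by
      rw [hqR]; field_simp
    have h2 := mul_le_mul_of_nonneg_left hpen (show 0 ≤ 3 * d * k ^ 3 * φ by positivity)
    rw [h1] at h2
    unfold potential
    rw [← hφdef]
    linarith
  have hend : (1 - 1 / k) * φ ≤ f S - 3 * d * k ^ 3 * φ *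
      ∑ r, (∑ i ∈ S, a i r - ∑ i, a i r * y₁ i) ^ 2 := by
    have h := hstart.trans hpot
    unfold potential at h
    rw [expExt_indicator] at h
    simpa only [penalty_indicator] using h
  have hV0 : 0 ≤ 3 * d * k ^ 3 * φ := by positivity
  refine ⟨?_, ?_⟩
  · by_contra hinf
    have hex : ∃ r, 1 < ∑ i ∈ S, a i r := by
      by_contra! h
      exact hinf (isFeasible_of_resCost hq0 hc hM hT hS h)
    obtain ⟨r₀, hr₀⟩ := hex
    -- The dimension that is exceeded by the largest factor `m`.
    obtain ⟨r, -, hr⟩ := Finset.exists_max_image Finset.univ (fun r => ∑ i ∈ S, a i r)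
      ⟨r₀, Finset.mem_univ r₀⟩
    set m := ∑ i ∈ S, a i r with hm
    have hm1 : 1 < m := hr₀.trans_le (hr r₀ (Finset.mem_univ _))
    have hfS : f S ≤ (2 * ∑ r, ∑ i ∈ S, a i r + 1) * opt := by
      refine hf.le_of_weight hf0 ha0 S (fun i hi r => ?_) fun A hA hA1 =>
        hopt A (isFeasible_of_resCost hq0 hc hM hT (fun i hi => hS i (hA hi)) hA1)
      refine (resCost_le hq0 hc (hS i hi) r).trans ?_
      exact one_div_le_one_div_of_le two_pos (by exact_mod_cast (by omega : 2 ≤ q))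
    have hsum : ∑ r, ∑ i ∈ S, a i r ≤ d * m := by
      simpa using Finset.sum_le_card_nsmul _ _ _ hr
    have h1 : f S ≤ 3 * d * m ^ 2 * opt := by
      refine hfS.trans (mul_le_mul_of_nonneg_right ?_ hopt0.le)
      have h3 : d * m ≤ d * m ^ 2 := mul_le_mul_of_nonneg_left (by nlinarith) hd0.le
      have h4 : 1 ≤ d * m ^ 2 := by nlinarith
      linarith
    have h2 : (1 / k * m) ^ 2 ≤ (∑ i ∈ S, a i r - ∑ i, a i r * y₁ i) ^ 2 := by
      refine pow_le_pow_left₀ (by positivity) ?_ 2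
      have := hslack r
      rw [← hm]
      nlinarith
    have h3 : (1 / k * m) ^ 2 ≤ ∑ r, (∑ i ∈ S, a i r - ∑ i, a i r * y₁ i) ^ 2 :=
      h2.trans (Finset.single_le_sum
        (f := fun r => (∑ i ∈ S, a i r - ∑ i, a i r * y₁ i) ^ 2)
        (fun r _ => sq_nonneg _) (Finset.mem_univ r))
    have h4 := mul_le_mul_of_nonneg_left h3 hV0
    have h5 : 3 * d * k ^ 3 * φ * (1 / k * m) ^ 2 = 3 * d * m ^ 2 * (k * φ) := by
      field_simp
    have h6 : opt ≤ k * φ := by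
      rw [one_div_mul_eq_div, div_le_iff₀ hk0] at hφ
      linarith
    have h7 := mul_le_mul_of_nonneg_left h6 (show 0 ≤ 3 * d * m ^ 2 by positivity)
    have h8 : 0 < (1 - 1 / k) * φ := mul_pos (by linarith) hφ0
    linarith
  · have h : 0 ≤ ∑ r, (∑ i ∈ S, a i r - ∑ i, a i r * y₁ i) ^ 2 :=
      Finset.sum_nonneg fun r _ => sq_nonneg _
    linarith [mul_nonneg hV0 h]

end Candidate

/-! ### The programs for the steps of the algorithm -/

section Programs

variable {X : Type} {π : X → Task} {E : X → Val} {d : ℕ}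

theorem polyBounded_size : PolyBounded π fun x => (π x).n :=
  ⟨Polynomial.X, fun _ => by simp⟩

theorem polyBounded_const (d : ℕ) : PolyBounded π fun _ => d :=
  ⟨Polynomial.C d, fun _ => by simp⟩

/-- Random access to the entries of a matrix with `d` columns. -/
theorem PolyTime.get₂ {a : ∀ x, Fin (π x).n → Fin d → ℝ} {i : ∀ x, Fin (π x).n} {r : X → Fin d}
    (ha : PolyTime π E fun x => Val.ofList (List.ofFn fun i => Val.ofVec (a x i)))
    (hi : PolyTime π E fun x => Val.num ((i x : ℕ) : ℝ))
    (hr : PolyTime π E fun x => Val.num ((r x : ℕ) : ℝ)) :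
    PolyTime π E fun x => Val.num (a x (i x) (r x)) :=
  PolyTime.get (a := fun x => a x (i x)) (polyBounded_const d)
    (PolyTime.lookup (v := fun x i => Val.ofVec (a x i)) polyBounded_size ha hi) hr

variable {c : ∀ x, Fin (π x).n → Fin d → ℝ} {L : X → Fin d → ℝ} {T : ∀ x, Finset (Fin (π x).n)}
  {M : X → ℝ} {q k : ℕ}

/-- The total cost of a set in dimension `r`. -/
theorem PolyTime.setCost (hn : Loopable π E fun x => (π x).n)
    (hc : PolyTime π E fun x => Val.ofList (List.ofFn fun i => Val.ofVec (c x i)))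
    (hT : PolyTime π E fun x => Val.ofSet (T x)) {r : X → Fin d}
    (hr : PolyTime π E fun x => Val.num ((r x : ℕ) : ℝ)) :
    PolyTime π E fun x => Val.num (∑ i ∈ T x, c x i (r x)) := by
  have h := PolyTime.sum hn (a := fun x i => if i ∈ T x then c x i (r x) else 0)
    (PolyTime.ite_num (PolyTest.mem polyBounded_size hT.weaken PolyTime.var)
      (PolyTime.get₂ hc.weaken PolyTime.var hr.weaken) PolyTime.zero)
  simpa only [Finset.sum_ite_mem, Finset.univ_inter] using h

theorem PolyTime.residual (hn : Loopable π E fun x => (π x).n)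
    (hc : PolyTime π E fun x => Val.ofList (List.ofFn fun i => Val.ofVec (c x i)))
    (hL : PolyTime π E fun x => Val.ofVec (L x)) (hT : PolyTime π E fun x => Val.ofSet (T x)) :
    PolyTime π E fun x => Val.ofVec (SubKnapsack.residual (c x) (L x) (T x)) :=
  PolyTime.ofVec (Loopable.const d)
    ((PolyTime.get (polyBounded_const d) hL.weaken PolyTime.var).sub
      (PolyTime.setCost hn.weaken hc.weaken hT.weaken PolyTime.var))

theorem PolyTest.isFeasible (hn : Loopable π E fun x => (π x).n)
    (hc : PolyTime π E fun x => Val.ofList (List.ofFn fun i => Val.ofVec (c x i)))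
    (hL : PolyTime π E fun x => Val.ofVec (L x)) (hT : PolyTime π E fun x => Val.ofSet (T x)) :
    PolyTest π E fun x => IsFeasible (c x) (L x) (T x) :=
  PolyTest.all (Loopable.const d)
    (PolyTest.le (PolyTime.setCost hn.weaken hc.weaken hT.weaken PolyTime.var)
      (PolyTime.get (polyBounded_const d) hL.weaken PolyTime.var))

theorem PolyTest.isSmall (hn : Loopable π E fun x => (π x).n)
    (hc : PolyTime π E fun x => Val.ofList (List.ofFn fun i => Val.ofVec (c x i)))
    (hL : PolyTime π E fun x => Val.ofVec (L x)) (hT : PolyTime π E fun x => Val.ofSet (T x))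
    {i : ∀ x, Fin (π x).n} (hi : PolyTime π E fun x => Val.num ((i x : ℕ) : ℝ)) :
    PolyTest π E fun x => IsSmall q (c x) (L x) (T x) (i x) :=
  PolyTest.all (Loopable.const d)
    (PolyTest.le ((PolyTime.natCast q).mul (PolyTime.get₂ hc.weaken hi.weaken PolyTime.var))
      (PolyTime.get (polyBounded_const d) (PolyTime.residual hn hc hL hT).weaken PolyTime.var))

theorem PolyTest.isAllowed (hn : Loopable π E fun x => (π x).n)
    (hc : PolyTime π E fun x => Val.ofList (List.ofFn fun i => Val.ofVec (c x i)))
    (hL : PolyTime π E fun x => Val.ofVec (L x)) (hT : PolyTime π E fun x => Val.ofSet (T x))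
    {i : ∀ x, Fin (π x).n} (hi : PolyTime π E fun x => Val.num ((i x : ℕ) : ℝ)) :
    PolyTest π E fun x => IsAllowed q (c x) (L x) (T x) (i x) :=
  (PolyTest.mem polyBounded_size hT hi).or (PolyTest.isSmall hn hc hL hT hi)

theorem PolyTime.resCost (hn : Loopable π E fun x => (π x).n)
    (hc : PolyTime π E fun x => Val.ofList (List.ofFn fun i => Val.ofVec (c x i)))
    (hL : PolyTime π E fun x => Val.ofVec (L x)) (hT : PolyTime π E fun x => Val.ofSet (T x))
    (hM : PolyTime π E fun x => Val.num (M x)) :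
    PolyTime π E fun x => Val.ofList (List.ofFn fun i =>
      Val.ofVec (SubKnapsack.resCost q (c x) (L x) (T x) (M x) i)) := by
  classical
  refine PolyTime.tabulate hn (PolyTime.ofVec (Loopable.const d) ?_)
  unfold SubKnapsack.resCost
  refine PolyTime.ite_num (PolyTest.mem polyBounded_size hT.weaken₂ PolyTime.var₂)
    PolyTime.zero (PolyTime.ite_num
      (PolyTest.isSmall hn.weaken₂ hc.weaken₂ hL.weaken₂ hT.weaken₂
        PolyTime.var₂) (PolyTime.div ?_ ?_) hM.weaken₂)
  · exact PolyTime.get₂ hc.weaken₂ PolyTime.var₂ PolyTime.var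
  · exact PolyTime.get (polyBounded_const d) (PolyTime.residual hn hc hL hT).weaken₂
      PolyTime.var

theorem PolyTime.shrink (hn : Loopable π E fun x => (π x).n)
    (hc : PolyTime π E fun x => Val.ofList (List.ofFn fun i => Val.ofVec (c x i)))
    (hL : PolyTime π E fun x => Val.ofVec (L x)) (hT : PolyTime π E fun x => Val.ofSet (T x))
    {y : ∀ x, Fin (π x).n → ℝ} (hy : PolyTime π E fun x => Val.ofVec (y x)) :
    PolyTime π E fun x => Val.ofVec (SubKnapsack.shrink q k (c x) (L x) (T x) (y x)) := by
  classical
  refine PolyTime.ofVec hn ?_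
  unfold SubKnapsack.shrink
  exact PolyTime.ite_num (PolyTest.isAllowed hn.weaken hc.weaken hL.weaken hT.weaken PolyTime.var)
    ((PolyTime.one.sub (PolyTime.one.div (PolyTime.natCast k))).mul
      (PolyTime.get polyBounded_size hy.weaken PolyTime.var)) PolyTime.zero

theorem PolyTime.twoPow (hn : Loopable π E fun x => (π x).n) :
    PolyTime π E fun x => Val.num (2 ^ (π x).n) := by
  have h := PolyTime.forRange hn (γ := fun _ => ℝ) (σ := fun _ => Val.num) (s₀ := fun _ => 1)
    (step := fun _ _ s => 2 * s) PolyTime.one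
    ((by simpa using PolyTime.natCast 2 : PolyTime _ _ _).mul
      (PolyTime.snd (PolyTime.snd PolyTime.id)))
  have key : ∀ {m : ℕ} (l : List (Fin m)), l.foldr (fun _ s => 2 * s) (1 : ℝ) = 2 ^ l.length := by
    intro m l
    induction l with
    | nil => simp
    | cons i l ih => rw [List.foldr_cons, ih, List.length_cons, pow_succ']
  simpa only [key, List.length_finRange] using h

theorem PolyTime.halfIndicator (hn : Loopable π E fun x => (π x).n)
    (hT : PolyTime π E fun x => Val.ofSet (T x)) :
    PolyTime π E fun x => Val.ofVec (SubKnapsack.halfIndicator (T x)) :=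
  PolyTime.ofVec hn (PolyTime.ite_num (PolyTest.mem polyBounded_size hT.weaken PolyTime.var)
    (PolyTime.one.div (by simpa using PolyTime.natCast 2)) PolyTime.zero)

theorem PolyTime.oracleSet (hT : PolyTime π E fun x => Val.ofSet (T x)) :
    PolyTime π E fun x => Val.num ((π x).G fun i => if i ∈ T x then 1 else 0) :=
  PolyTime.oracle hT fun x i => by split_ifs <;> norm_num

theorem PolyTime.potential (hn : Loopable π E fun x => (π x).n)
    {a : ∀ x, Fin (π x).n → Fin d → ℝ} {V : X → ℝ} {μ z : ∀ x, Fin (π x).n → ℝ}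
    (ha : PolyTime π E fun x => Val.ofList (List.ofFn fun i => Val.ofVec (a x i)))
    (hV : PolyTime π E fun x => Val.num (V x)) (hμ : PolyTime π E fun x => Val.ofVec (μ x))
    (hz : PolyTime π E fun x => Val.ofVec (z x)) (hz01 : ∀ x i, 0 ≤ z x i ∧ z x i ≤ 1) :
    PolyTime π E fun x => Val.num (SubKnapsack.potential (π x).G (a x) (V x) (μ x) (z x)) := by
  refine (PolyTime.oracle hz hz01).sub (hV.mul (PolyTime.sum (Loopable.const d) ?_))
  have hbias : PolyTime (fun w : Σ _ : X, Fin d => π w.1)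
      (fun w => Val.pair (E w.1) (Val.num ((w.2 : ℕ) : ℝ)))
      fun w => Val.num (∑ i, a w.1 i w.2 * (z w.1 i - μ w.1 i)) :=
    PolyTime.sum hn.weaken ((PolyTime.get₂ ha.weaken₂ PolyTime.var PolyTime.var₂).mul
      ((PolyTime.get polyBounded_size hz.weaken₂ PolyTime.var).sub
        (PolyTime.get polyBounded_size hμ.weaken₂ PolyTime.var)))
  refine (PolyTime.sum hn.weaken ?_).add (hbias.mul hbias)
  exact ((PolyTime.get₂ ha.weaken₂ PolyTime.var PolyTime.var₂).mul
    (PolyTime.get₂ ha.weaken₂ PolyTime.var PolyTime.var₂)).mul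
    ((PolyTime.get polyBounded_size hz.weaken₂ PolyTime.var).mul
      (PolyTime.one.sub (PolyTime.get polyBounded_size hz.weaken₂ PolyTime.var)))

theorem PolyTime.cubeSet (hn : Loopable π E fun x => (π x).n) {z : ∀ x, Cube (π x).n}
    {i : ∀ x, Fin (π x).n} (b : Bool) (hz : PolyTime π E fun x => Val.ofVec (z x).1)
    (hi : PolyTime π E fun x => Val.num ((i x : ℕ) : ℝ)) :
    PolyTime π E fun x => Val.ofVec ((z x).set (i x) b).1 :=
  PolyTime.update hn hz hi (by cases b <;> simp [PolyTime.zero, PolyTime.one])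

theorem PolyTime.roundSet (hn : Loopable π E fun x => (π x).n)
    {a : ∀ x, Fin (π x).n → Fin d → ℝ} {V : X → ℝ} {μ : ∀ x, Fin (π x).n → ℝ}
    {z : ∀ x, Cube (π x).n}
    (ha : PolyTime π E fun x => Val.ofList (List.ofFn fun i => Val.ofVec (a x i)))
    (hV : PolyTime π E fun x => Val.num (V x)) (hμ : PolyTime π E fun x => Val.ofVec (μ x))
    (hz : PolyTime π E fun x => Val.ofVec (z x).1) :
    PolyTime π E fun x => Val.ofSet
      (SubKnapsack.roundSet (SubKnapsack.potential (π x).G (a x) (V x) (μ x)) (z x)) := by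
  classical
  have h := PolyTime.forRange hn (γ := fun x => Cube (π x).n) (σ := fun _ z => Val.ofVec z.1)
    (s₀ := z)
    (step := fun x => roundStep (SubKnapsack.potential (π x).G (a x) (V x) (μ x))) hz (by
      have hi : PolyTime (fun w : Σ x, Fin (π x).n × Cube (π x).n => π w.1)
          (fun w => Val.pair (E w.1) (Val.pair (Val.num ((w.2.1 : ℕ) : ℝ)) (Val.ofVec w.2.2.1)))
          fun w => Val.num ((w.2.1 : ℕ) : ℝ) := PolyTime.fst (PolyTime.snd PolyTime.id)
      have hz' : PolyTime (fun w : Σ x, Fin (π x).n × Cube (π x).n => π w.1)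
          (fun w => Val.pair (E w.1) (Val.pair (Val.num ((w.2.1 : ℕ) : ℝ)) (Val.ofVec w.2.2.1)))
          fun w => Val.ofVec w.2.2.1 := PolyTime.snd (PolyTime.snd PolyTime.id)
      have hset := fun b => PolyTime.cubeSet hn.weaken b hz' hi
      have hpot := fun b => PolyTime.potential hn.weaken ha.weaken hV.weaken hμ.weaken (hset b)
        fun w => (w.2.2.set w.2.1 b).2
      convert PolyTime.ite (PolyTest.le (PolyTime.get polyBounded_size hz' hi) PolyTime.zero) hz'
        (PolyTime.ite (PolyTest.le (hpot false) (hpot true)) (hset true) (hset false))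
        using 2 with w
      unfold roundStep
      split_ifs <;> rfl)
  have h2 := PolyTime.ofVec hn (a := fun x i =>
    if 1 ≤ (roundAll (SubKnapsack.potential (π x).G (a x) (V x) (μ x)) (z x)).1 i then 1 else 0)
    (PolyTime.ite_num (PolyTest.le PolyTime.one (PolyTime.get polyBounded_size h.weaken
      PolyTime.var)) PolyTime.one PolyTime.zero)
  unfold Val.ofSet SubKnapsack.roundSet
  convert h2 using 3 with x
  ext i
  simp

end Programs

/-! ### Exhaustive search over small sets -/

section Search

variable {n : ℕ}

open Classical in
/-- The one of two sets that has the larger value, for an objective given by its extension `G`. -/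
noncomputable def better (G : (Fin n → ℝ) → ℝ) (R S : Finset (Fin n)) : Finset (Fin n) :=
  if G (fun i => if i ∈ R then 1 else 0) ≤ G (fun i => if i ∈ S then 1 else 0) then S else R

/-- The best of the candidates `S T'`, where `T'` arises from `T` by adding at most `k` elements. -/
noncomputable def bestWithin (G : (Fin n → ℝ) → ℝ) (S : Finset (Fin n) → Finset (Fin n)) :
    ℕ → Finset (Fin n) → Finset (Fin n)
  | 0, T => S T
  | k + 1, T => (List.finRange n).foldr
      (fun i R => better G R (bestWithin G S k (insert i T))) (bestWithin G S k T)

variable {f : Finset (Fin n) → ℝ}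

theorem better_spec (f : Finset (Fin n) → ℝ) (R S : Finset (Fin n)) :
    f R ≤ f (better (expExt f) R S) ∧ f S ≤ f (better (expExt f) R S) ∧
      (better (expExt f) R S = R ∨ better (expExt f) R S = S) := by
  unfold better
  simp only [expExt_indicator]
  split_ifs with h
  · exact ⟨h, le_rfl, Or.inr rfl⟩
  · exact ⟨le_rfl, (not_le.1 h).le, Or.inl rfl⟩

theorem foldr_better_spec (f : Finset (Fin n) → ℝ) (g : Fin n → Finset (Fin n))
    (R : Finset (Fin n)) (l : List (Fin n)) :
    f R ≤ f (l.foldr (fun i R => better (expExt f) R (g i)) R) ∧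
      (∀ i ∈ l, f (g i) ≤ f (l.foldr (fun i R => better (expExt f) R (g i)) R)) ∧
      ∀ P : Finset (Fin n) → Prop, P R → (∀ i, P (g i)) →
        P (l.foldr (fun i R => better (expExt f) R (g i)) R) := by
  induction l with
  | nil => exact ⟨le_rfl, by simp, fun P hR _ => hR⟩
  | cons j l ih =>
    obtain ⟨h1, h2, h3⟩ := ih
    obtain ⟨b1, b2, b3⟩ := better_spec f (l.foldr (fun i R => better (expExt f) R (g i)) R) (g j)
    rw [List.foldr_cons]
    refine ⟨h1.trans b1, fun i hi => ?_, fun P hR hg => ?_⟩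
    · rcases List.mem_cons.1 hi with rfl | hi
      · exact b2
      · exact (h2 i hi).trans b1
    · rcases b3 with h | h <;> rw [h]
      · exact h3 P hR hg
      · exact hg j

theorem bestWithin_prop {S : Finset (Fin n) → Finset (Fin n)} {P : Finset (Fin n) → Prop}
    (hP : ∀ T, P (S T)) (k : ℕ) (T : Finset (Fin n)) : P (bestWithin (expExt f) S k T) := by
  induction k generalizing T with
  | zero => exact hP T
  | succ k ih => exact (foldr_better_spec f _ _ _).2.2 P (ih T) fun i => ih _

theorem le_bestWithin (S : Finset (Fin n) → Finset (Fin n)) (k : ℕ) {T T' : Finset (Fin n)}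
    (hT : T ⊆ T') (hk : (T' \ T).card ≤ k) : f (S T') ≤ f (bestWithin (expExt f) S k T) := by
  induction k generalizing T with
  | zero =>
    have h : T' \ T = ∅ := Finset.card_eq_zero.1 (Nat.le_zero.1 hk)
    rw [Finset.Subset.antisymm hT (Finset.sdiff_eq_empty_iff_subset.1 h)]
    exact le_rfl
  | succ k ih =>
    obtain ⟨h1, h2, -⟩ := foldr_better_spec f (fun i => bestWithin (expExt f) S k (insert i T))
      (bestWithin (expExt f) S k T) (List.finRange n)
    rcases (T' \ T).eq_empty_or_nonempty with h | ⟨i, hi⟩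
    · exact (ih hT (by rw [h]; simp)).trans h1
    · have hiT := Finset.mem_sdiff.1 hi
      refine le_trans (ih (Finset.insert_subset hiT.1 hT) ?_) (h2 i (List.mem_finRange i))
      have h3 : T' \ insert i T = (T' \ T).erase i := by
        rw [Finset.sdiff_insert, Finset.erase_eq]
      rw [h3, Finset.card_erase_of_mem hi]
      omega

theorem PolyTime.better {X : Type} {π : X → Task} {E : X → Val}
    {R S : ∀ x, Finset (Fin (π x).n)} (hR : PolyTime π E fun x => Val.ofSet (R x))
    (hS : PolyTime π E fun x => Val.ofSet (S x)) :
    PolyTime π E fun x => Val.ofSet (SubKnapsack.better (π x).G (R x) (S x)) := by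
  convert PolyTime.ite (PolyTest.le (PolyTime.oracleSet hR) (PolyTime.oracleSet hS)) hS hR
    using 2 with x
  unfold SubKnapsack.better
  split_ifs <;> rfl

theorem PolyTime.bestWithin {X : Type} {π : X → Task} {E : X → Val}
    (hn : Loopable π E fun x => (π x).n) {S : ∀ x, Finset (Fin (π x).n) → Finset (Fin (π x).n)}
    (hS : PolyTime (fun z : Σ x, Finset (Fin (π x).n) => π z.1)
      (fun z => Val.pair (E z.1) (Val.ofSet z.2)) fun z => Val.ofSet (S z.1 z.2)) (k : ℕ) :
    PolyTime (fun z : Σ x, Finset (Fin (π x).n) => π z.1)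
      (fun z => Val.pair (E z.1) (Val.ofSet z.2))
      fun z => Val.ofSet (SubKnapsack.bestWithin (π z.1).G (S z.1) k z.2) := by
  induction k with
  | zero => exact hS
  | succ k ih =>
    have hins : PolyTime
        (fun w : Σ z : Σ x, Finset (Fin (π x).n), Fin (π z.1).n × Finset (Fin (π z.1).n) => π w.1.1)
        (fun w => Val.pair (Val.pair (E w.1.1) (Val.ofSet w.1.2))
          (Val.pair (Val.num ((w.2.1 : ℕ) : ℝ)) (Val.ofSet w.2.2)))
        fun w => Val.ofSet (Insert.insert w.2.1 w.1.2) :=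
      PolyTime.insert hn.weaken₂ PolyTime.var₂ (PolyTime.fst PolyTime.var)
    exact PolyTime.forRange (X := Σ x, Finset (Fin (π x).n)) (π := fun z => π z.1)
      (m := fun z => (π z.1).n) hn.weaken (γ := fun z => Finset (Fin (π z.1).n))
      (σ := fun _ => Val.ofSet) (s₀ := fun z => SubKnapsack.bestWithin (π z.1).G (S z.1) k z.2)
      (step := fun z i R => SubKnapsack.better (π z.1).G R
        (SubKnapsack.bestWithin (π z.1).G (S z.1) k (Insert.insert i z.2))) ih
      (PolyTime.better (PolyTime.snd PolyTime.var)
        (((PolyTime.fst (PolyTime.fst PolyTime.id)).pair hins).comp (ih.reindex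
          fun w : Σ z : Σ x, Finset (Fin (π x).n), Fin (π z.1).n × Finset (Fin (π z.1).n) =>
            ⟨w.1.1, Insert.insert w.2.1 w.1.2⟩)))

end Search

/-! ### The algorithm -/

section Algorithm

variable {n d : ℕ}

/-- A cost that limits the share of an element so much that dropping the element costs at most a
`1/k` fraction of the average value of the subsets of `T`. -/
noncomputable def prohibitiveCost (k : ℕ) (G : (Fin n → ℝ) → ℝ) (T : Finset (Fin n)) : ℝ :=
  2 ^ n * G (fun _ => 1 / 2) * k / G (halfIndicator T)

/-- The cost vectors of the continuous instance that belongs to the guess `T`. -/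
noncomputable def guessCost (q k : ℕ) (G : (Fin n → ℝ) → ℝ) (c : Fin n → Fin d → ℝ)
    (L : Fin d → ℝ) (T : Finset (Fin n)) : Fin n → Fin d → ℝ :=
  resCost q c L T (prohibitiveCost k G T)

theorem shrink_mem (q k : ℕ) (c : Fin n → Fin d → ℝ) (L : Fin d → ℝ) (T : Finset (Fin n))
    {y : Fin n → ℝ} (hy : ∀ i, 0 ≤ y i ∧ y i ≤ 1) (i : Fin n) :
    0 ≤ shrink q k c L T y i ∧ shrink q k c L T y i ≤ 1 := by
  have h0 : 0 ≤ 1 / (k : ℝ) := by positivity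
  have h1 : 1 / (k : ℝ) ≤ 1 := by
    rw [one_div]; exact Nat.cast_inv_le_one k
  unfold shrink
  split_ifs
  · exact ⟨mul_nonneg (by linarith) (hy i).1, mul_le_one₀ (by linarith) (hy i).1 (hy i).2⟩
  · norm_num

/-- The result of rounding a solution `y` of the continuous instance for the guess `T`. -/
noncomputable def rounded (q k : ℕ) (G : (Fin n → ℝ) → ℝ) (c : Fin n → Fin d → ℝ)
    (L : Fin d → ℝ) (T : Finset (Fin n)) (y : Cube n) : Finset (Fin n) :=
  roundSet (potential G (guessCost q k G c L T) (3 * d * k ^ 3 * G (shrink q k c L T y.1))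
    (shrink q k c L T y.1)) ⟨shrink q k c L T y.1, shrink_mem q k c L T y.2⟩

open Classical in
/-- The candidate for the guess `T`: the rounded solution, unless it is infeasible or worse than the
empty set. -/
noncomputable def candidate (q k : ℕ) (G : (Fin n → ℝ) → ℝ) (c : Fin n → Fin d → ℝ)
    (L : Fin d → ℝ) (T : Finset (Fin n)) (y : Cube n) : Finset (Fin n) :=
  if IsFeasible c L (rounded q k G c L T y) then better G ∅ (rounded q k G c L T y) else ∅

theorem candidate_feasible {q k : ℕ} {f : Finset (Fin n) → ℝ} {c : Fin n → Fin d → ℝ}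
    {L : Fin d → ℝ} (hL : ∀ r, 0 ≤ L r) (T : Finset (Fin n)) (y : Cube n) :
    IsFeasible c L (candidate q k (expExt f) c L T y) ∧
      f ∅ ≤ f (candidate q k (expExt f) c L T y) := by
  have h0 : IsFeasible c L ∅ := fun r => by simpa using hL r
  unfold candidate
  split_ifs with h
  · obtain ⟨h1, -, h2 | h2⟩ := better_spec f ∅ (rounded q k (expExt f) c L T y)
    · rw [h2]
      exact ⟨h0, le_rfl⟩
    · rw [h2] at h1 ⊢
      exact ⟨h, h1⟩
  · exact ⟨h0, le_rfl⟩

/-- For a right guess `T` the candidate is nearly as good as the fractional solution. -/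
theorem candidate_value {q k : ℕ} {f : Finset (Fin n) → ℝ} (hf : IsSubmodular f)
    (hf0 : ∀ S, 0 ≤ f S) {c : Fin n → Fin d → ℝ} {L : Fin d → ℝ} (hc : ∀ i r, 0 ≤ c i r)
    (hd : 1 ≤ d) (hk : 2 ≤ k) (hq : q = 3 * d ^ 2 * k ^ 4) {opt : ℝ} (hopt0 : 0 < opt)
    (hopt : ∀ R, IsFeasible c L R → f R ≤ opt) {T S' : Finset (Fin n)}
    (hS' : IsFeasible c L S') (hTS' : T ⊆ S') (hsmall : ∀ i ∈ S', i ∉ T → IsSmall q c L T i)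
    (hval : (1 - 1 / k) * opt ≤ f S') (hpos : 0 < expExt f (halfIndicator T)) {α : ℝ}
    (hα0 : 4 / k ≤ α) (hα1 : α ≤ 1) (y : Cube n)
    (hy : y.1 ∈ polytope (guessCost q k (expExt f) c L T) (fun _ => 1))
    (hyα : α * optValue f (guessCost q k (expExt f) c L T) (fun _ => 1) ≤ expExt f y.1) :
    (α - 4 / k) * opt ≤ f (candidate q k (expExt f) c L T y) := by
  have hk0 : (0 : ℝ) < k := by positivity
  set u := 1 / (k : ℝ) with hu
  have hu0 : 0 < u := by positivity
  have hu1 : u ≤ 1 := by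
    rw [hu, div_le_one hk0]; exact_mod_cast (by omega : 1 ≤ k)
  have h3 : 3 / (k : ℝ) = 3 * u := by rw [hu]; ring
  have h4 : 4 / (k : ℝ) = 4 * u := by rw [hu]; ring
  have hM : 0 ≤ prohibitiveCost k (expExt f) T := by
    have := expExt_nonneg hf0 (y := fun _ => 1 / 2) fun _ => by norm_num
    unfold prohibitiveCost
    positivity
  have hφ := le_expExt_shrink hf hf0 hc hd (by omega) hopt hS' hTS' hsmall hval hpos
    ((by positivity : 0 ≤ 4 / (k : ℝ)).trans hα0) hα1 rfl hy hyα
  rw [h3] at hφ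
  rw [h4] at hα0 ⊢
  have hφ' : u * opt ≤ expExt f (shrink q k c L T y.1) :=
    (mul_le_mul_of_nonneg_right (by linarith) hopt0.le).trans hφ
  obtain ⟨hpot, hround⟩ := roundAll_spec ((coordAffine_expExt f).potential
    (guessCost q k (expExt f) c L T) (3 * d * k ^ 3 * expExt f (shrink q k c L T y.1))
    (shrink q k c L T y.1)) ⟨shrink q k c L T y.1, shrink_mem q k c L T y.2⟩
  have hind := roundAll_eq_indicator ((coordAffine_expExt f).potential
    (guessCost q k (expExt f) c L T) (3 * d * k ^ 3 * expExt f (shrink q k c L T y.1))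
    (shrink q k c L T y.1)) ⟨shrink q k c L T y.1, shrink_mem q k c L T y.2⟩
  change _ = fun i => if i ∈ rounded q k (expExt f) c L T y then 1 else 0 at hind
  rw [hind] at hpot hround
  have hallowed : ∀ i ∈ rounded q k (expExt f) c L T y, IsAllowed q c L T i := by
    intro i hi
    by_contra h
    have h0 := (hround i).2 (by simp only [shrink, if_neg h])
    simp [hi] at h0
  obtain ⟨hfeas, hle⟩ := isFeasible_and_le_of_potential hf hf0 hc hM hd hk hq hopt0 hopt
    (hS'.mono hc hTS') hy hφ' hallowed hpot
  rw [candidate, if_pos hfeas]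
  refine le_trans ?_ (hle.trans (better_spec f ∅ _).2.1)
  rw [← hu]
  refine le_trans ?_ (mul_le_mul_of_nonneg_left hφ (by linarith))
  have h5 : (1 - u) * ((α - 3 * u) * opt) - (α - 4 * u) * opt =
      opt * (u * (1 - α) + 3 * u * u) := by ring
  have h6 : 0 ≤ opt * (u * (1 - α) + 3 * u * u) := by
    have : 0 ≤ 1 - α := by linarith
    positivity
  linarith

variable {X : Type} {π : X → Task} {E : X → Val} {c : ∀ x, Fin (π x).n → Fin d → ℝ}
  {L : X → Fin d → ℝ} {T : ∀ x, Finset (Fin (π x).n)} {q k : ℕ}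

theorem PolyTime.guessCost (hn : Loopable π E fun x => (π x).n)
    (hc : PolyTime π E fun x => Val.ofList (List.ofFn fun i => Val.ofVec (c x i)))
    (hL : PolyTime π E fun x => Val.ofVec (L x)) (hT : PolyTime π E fun x => Val.ofSet (T x)) :
    PolyTime π E fun x => Val.ofList (List.ofFn fun i =>
      Val.ofVec (SubKnapsack.guessCost q k (π x).G (c x) (L x) (T x) i)) := by
  refine PolyTime.resCost hn hc hL hT (PolyTime.div (((PolyTime.twoPow hn).mul ?_).mul
    (PolyTime.natCast k)) (PolyTime.oracle (PolyTime.halfIndicator hn hT)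
      fun x => halfIndicator_mem (T x)))
  refine PolyTime.oracle (PolyTime.ofVec hn ?_) fun _ _ => by norm_num
  exact PolyTime.one.div (by simpa using PolyTime.natCast 2)

theorem PolyTime.candidate (hn : Loopable π E fun x => (π x).n)
    (hc : PolyTime π E fun x => Val.ofList (List.ofFn fun i => Val.ofVec (c x i)))
    (hL : PolyTime π E fun x => Val.ofVec (L x)) (hT : PolyTime π E fun x => Val.ofSet (T x))
    {y : ∀ x, Cube (π x).n} (hy : PolyTime π E fun x => Val.ofVec (y x).1) :
    PolyTime π E fun x =>
      Val.ofSet (SubKnapsack.candidate q k (π x).G (c x) (L x) (T x) (y x)) := by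
  classical
  have hs := PolyTime.shrink (q := q) (k := k) hn hc hL hT hy
  have hempty : PolyTime π E fun x => Val.ofSet (∅ : Finset (Fin (π x).n)) :=
    PolyTime.ofVec hn (by simpa using PolyTime.zero)
  have hV : PolyTime π E fun x => Val.num (3 * d * k ^ 3 *
      (π x).G (SubKnapsack.shrink q k (c x) (L x) (T x) (y x).1)) :=
    PolyTime.mul (by exact_mod_cast PolyTime.natCast (3 * d * k ^ 3))
      (PolyTime.oracle hs fun x => shrink_mem q k (c x) (L x) (T x) (y x).2)
  have hr : PolyTime π E fun x =>
      Val.ofSet (rounded q k (π x).G (c x) (L x) (T x) (y x)) :=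
    PolyTime.roundSet hn (PolyTime.guessCost hn hc hL hT) hV hs hs
  convert PolyTime.ite (PolyTest.isFeasible hn hc hL hr) (PolyTime.better hempty hr) hempty
    using 2 with x
  unfold SubKnapsack.candidate
  split_ifs <;> rfl

end Algorithm

/-- An instance of the discrete problem with an objective function from the class `𝓕`. -/
structure Inst (d : ℕ) (𝓕 : ∀ n : ℕ, Set (Finset (Fin n) → ℝ)) where
  /-- The size of the universe. -/
  n : ℕ
  /-- The objective function. -/
  f : Finset (Fin n) → ℝ
  /-- The cost vectors. -/
  c : Fin n → Fin d → ℝ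
  /-- The budget vector. -/
  L : Fin d → ℝ
  f_mem : f ∈ 𝓕 n
  c_nonneg : ∀ i r, 0 ≤ c i r
  L_nonneg : ∀ r, 0 ≤ L r

/-- The size and the oracle of an instance. -/
noncomputable abbrev Inst.task {d : ℕ} {𝓕 : ∀ n : ℕ, Set (Finset (Fin n) → ℝ)} (x : Inst d 𝓕) :
    Task :=
  ⟨x.n, expExt x.f⟩

theorem IsContinuousApprox.exists_isDiscreteApprox {d : ℕ} (hd : 1 ≤ d)
    {𝓕 : ∀ n : ℕ, Set (Finset (Fin n) → ℝ)}
    (h𝓕 : ∀ (n : ℕ), ∀ f ∈ 𝓕 n, IsSubmodular f ∧ ∀ S, 0 ≤ f S) {α : ℝ} (hα1 : α ≤ 1)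
    {A : Code} (hA : IsContinuousApprox d 𝓕 α A) {ε : ℝ} (hε : 0 < ε) :
    ∃ B : Code, IsDiscreteApprox d 𝓕 (α - ε) B := by
  obtain ⟨pA, hA⟩ := hA
  obtain ⟨m, hm⟩ := exists_nat_ge (4 / ε)
  -- The accuracy `1 / k` and the threshold `1 / q` for small elements.
  obtain ⟨k, hk2, hkε⟩ : ∃ k : ℕ, 2 ≤ k ∧ 4 / (k : ℝ) ≤ ε := by
    refine ⟨m + 2, by omega, ?_⟩
    rw [div_le_iff₀ (by positivity)]
    rw [div_le_iff₀ hε] at hm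
    push_cast
    nlinarith
  obtain ⟨q, hq⟩ : ∃ q, q = 3 * d ^ 2 * k ^ 4 := ⟨_, rfl⟩
  let E : Inst d 𝓕 → Val := fun x => Val.ofInstance x.c x.L
  have hinst : PolyTime Inst.task E fun x => Val.ofInstance x.c x.L := PolyTime.id
  have hn : Loopable Inst.task E fun x => x.task.n := by
    simpa using Loopable.ofList hinst.fst ⟨Polynomial.X, fun x => by simp⟩
  -- The calls of the given algorithm, for all instances `z.1` and all guesses `z.2`.
  have hcall := fun z : Σ x : Inst d 𝓕, Finset (Fin x.n) =>
    hA z.1.n z.1.f z.1.f_mem (guessCost q k (expExt z.1.f) z.1.c z.1.L z.2) (fun _ => 1)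
      (resCost_nonneg z.1.c_nonneg (by
        have hf0 := (h𝓕 _ _ z.1.f_mem).2
        have h1 := expExt_nonneg hf0 (y := fun _ => 1 / 2) fun _ => by norm_num
        have h2 := expExt_nonneg hf0 (halfIndicator_mem z.2)
        unfold prohibitiveCost
        positivity)) fun _ => zero_le_one
  choose y t hyt htp hyP hyα using hcall
  let y' : ∀ z : Σ x : Inst d 𝓕, Finset (Fin x.n), Cube z.1.n := fun z => ⟨y z, (hyP z).1⟩
  have hy : PolyTime (fun z : Σ x : Inst d 𝓕, Finset (Fin x.n) => z.1.task)
      (fun z => Val.pair (E z.1) (Val.ofSet z.2)) fun z => Val.ofVec (y' z).1 := by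
    refine PolyTime.comp ((PolyTime.guessCost (q := q) (k := k) hn.weaken hinst.fst.weaken
      hinst.snd.weaken PolyTime.var).pair ?_) ⟨A, pA, fun z => ⟨t z, hyt z, htp z⟩⟩
    exact PolyTime.ofVec (Loopable.const d) PolyTime.one
  have hcand := PolyTime.candidate (q := q) (k := k) hn.weaken hinst.fst.weaken
    hinst.snd.weaken PolyTime.var hy
  have hbest := PolyTime.bestWithin hn
    (S := fun x T => candidate q k (expExt x.f) x.c x.L T (y' ⟨x, T⟩)) hcand (1 + k * (d * q))
  have hempty : PolyTime Inst.task E fun x => Val.ofSet (∅ : Finset (Fin x.n)) :=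
    PolyTime.ofVec hn (by simpa using PolyTime.zero)
  obtain ⟨B, pB, hB⟩ := (PolyTime.id.pair hempty).comp
    (hbest.reindex fun x : Inst d 𝓕 => ⟨x, ∅⟩)
  refine ⟨B, pB, fun n f hf c L hc hL => ?_⟩
  obtain ⟨hsub, hf0⟩ := h𝓕 n f hf
  let x : Inst d 𝓕 := ⟨n, f, c, L, hf, hc, hL⟩
  obtain ⟨s, hs, hsB⟩ := hB x
  refine ⟨_, s, hs, hsB, ?_⟩
  have hprop := fun T => candidate_feasible (q := q) (k := k) (f := f) (c := c) hL T
    (y' ⟨x, T⟩)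
  obtain ⟨hout, hout0⟩ := bestWithin_prop (f := f)
    (P := fun S => IsFeasible c L S ∧ f ∅ ≤ f S) hprop (1 + k * (d * q)) ∅
  refine ⟨hout, ?_⟩
  -- An optimal solution.
  obtain ⟨S, hS, hSopt⟩ : optValue f c L ∈ f '' {S | IsFeasible c L S} :=
    Set.Nonempty.csSup_mem ⟨f ∅, ∅, fun r => by simpa using hL r, rfl⟩
      ((Set.toFinite _).image f)
  have hmax : ∀ R, IsFeasible c L R → f R ≤ f S := fun R hR => hSopt ▸ le_optValue hR
  rw [← hSopt]
  by_cases hα : α < 4 / k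
  · exact (mul_nonpos_of_nonpos_of_nonneg (by linarith) (hf0 S)).trans (hf0 _)
  by_cases hSe : f S ≤ f ∅
  · exact (mul_le_of_le_one_left (hf0 S) (by linarith)).trans (hSe.trans hout0)
  obtain ⟨i, hi, hfi⟩ := hsub.exists_pos_singleton hf0 (not_le.1 hSe)
  obtain ⟨T, S', hiT, hTcard, hTS', hS'S, hsmall, hval⟩ :=
    exists_guess hsub hf0 hc hS hmax hi q (k := k) (by omega)
  refine le_trans ?_ (le_bestWithin _ (1 + k * (d * q)) (Finset.empty_subset T)
    (by simpa using hTcard))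
  refine le_trans (mul_le_mul_of_nonneg_right (by linarith) (hf0 S)) (candidate_value hsub hf0 hc hd
    hk2 hq ((hf0 ∅).trans_lt (not_le.1 hSe)) hmax (IsFeasible.mono hc hS hS'S) hTS' hsmall hval
    (expExt_halfIndicator_pos hf0 hiT hfi) (not_lt.1 hα) hα1 (y' ⟨x, T⟩)
    (hyP ⟨x, T⟩) (hyα ⟨x, T⟩))

end SubKnapsack

theorem mainTheorem4 (d : ℕ) (hd : 1 ≤ d)
    (𝓕 : ∀ n : ℕ, Set (Finset (Fin n) → ℝ))
    (h𝓕 : ∀ (n : ℕ), ∀ f ∈ 𝓕 n, SubKnapsack.IsSubmodular f ∧ ∀ S, 0 ≤ f S)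
    (α : ℝ) (hα0 : 0 < α) (hα1 : α ≤ 1)
    (hA : ∃ A : SubKnapsack.Code, SubKnapsack.IsContinuousApprox d 𝓕 α A) :
    ∀ ε : ℝ, 0 < ε →
      ∃ B : SubKnapsack.Code, SubKnapsack.IsDiscreteApprox d 𝓕 (α - ε) B := by
  intro ε hε
  obtain ⟨A, hA⟩ := hA
  exact hA.exists_isDiscreteApprox hd h𝓕 hα1 hε
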